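/- Let $K$ be a field and let $L$ be an $n$-dimensional nilpotent Lie algebra over $K$ of nilpotency class exactly two, with derived subalgebra $L^2=[L,L]$ of dimension $m$. Let $\mathcal M(L)=(R\cap F^2)/[R,F]$ be its Schur multiplier, where $L\cong F/R$ with $F$ a free Lie algebra over $K$ (any such free presentation may be used). Then $\mathcal M(L)$ is finite-dimensional, and $$\dim \mathcal M(L)=\tfrac12(n-m-1)(n+m)-\sum_{i=2}^{\min\{n-m,\,2\}}(n-m-i)$$ (that is, $\dim\mathcal M(L)$ attains Rai's upper bound $\tfrac12(n-m-1)(n+m)-\sum_{i=2}^{\min\{n-m,\,c\}}(n-m-i)$ for nilpotent Lie algebras of class $c$, with $c=2$) if and only if $L$ is isomorphic to one of the Lie algebras $H(1)\oplus A(n-3)$, $L_{5,8}$ or $L_{6,26}$. Here $A(k)$ is the abelian Lie algebra of dimension $k$, and, listing only the nonzero brackets of basis vectors up to antisymmetry, $H(1)=\langle x_1,x_2,x_3\mid [x_1,x_2]=x_3\rangle$ is the Heisenberg algebra of dimension $3$, $L_{5,8}=\langle x_1,\dots,x_5\mid [x_1,x_2]=x_4,\ [x_1,x_3]=x_5\rangle$,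 and $L_{6,26}=\langle x_1,\dots,x_6\mid [x_1,x_2]=x_4,\ [x_1,x_3]=x_5,\ [x_2,x_3]=x_6\rangle$. -/

import Mathlib

/-- The Schur multiplier `(R ∩ F²) / [R, F]` of the Lie algebra `L ≅ F / R`, computed from a
free presentation `π : F → L`, where `F` is the free Lie algebra on a set `X` and `R = ker π`.
It is used for surjective `π` only. -/
abbrev SchurMultiplier {K : Type*} [Field K] {L : Type*} [LieRing L] [LieAlgebra K L]
    {X : Type*} (π : FreeLieAlgebra K X →ₗ⁅K⁆ L) : Type _ :=
  let F := FreeLieAlgebra K X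
  let R : LieIdeal K F := π.ker
  let F2 : LieIdeal K F := ⁅(⊤ : LieIdeal K F), (⊤ : LieIdeal K F)⁆
  let RF : LieIdeal K F := ⁅R, (⊤ : LieIdeal K F)⁆
  (R ⊓ F2).toSubmodule ⧸ Submodule.comap (R ⊓ F2).toSubmodule.subtype RF.toSubmodule

/-- The upper bound `(n - m - 1)(n + m) / 2 - ∑_{i = 2}^{min (n - m, c)} (n - m - i)` for the
dimension of the Schur multiplier of a nilpotent Lie algebra of dimension `n` and class `c`
whose derived subalgebra has dimension `m` (so that `m ≤ n`). -/
def raiBound (n m c : ℕ) : ℚ :=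
  ((n : ℚ) - m - 1) * (n + m) / 2 - ∑ i ∈ Finset.Icc 2 (min (n - m) c), ((n : ℚ) - m - i)

/-- The underlying space of the abelian Lie algebra `A(k)`. -/
def AbelianLie (K : Type*) (k : ℕ) : Type _ := Fin k → K

namespace AbelianLie

variable (K : Type*) [Field K] (k : ℕ)

instance : AddCommGroup (AbelianLie K k) := inferInstanceAs (AddCommGroup (Fin k → K))

instance : Module K (AbelianLie K k) := inferInstanceAs (Module K (Fin k → K))

instance : LieRing (AbelianLie K k) where
  bracket _ _ := 0
  add_lie _ _ _ := by simp
  lie_add _ _ _ := by simp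
  lie_self _ := rfl
  leibniz_lie _ _ _ := by simp

instance : LieAlgebra K (AbelianLie K k) where
  lie_smul _ _ _ := (smul_zero _).symm

end AbelianLie

/-- The underlying space of the Heisenberg Lie algebra `H(1)`: basis `x₁, x₂, x₃` (coordinates
`0, 1, 2`), the only nonzero bracket of basis vectors, up to antisymmetry, being
`[x₁, x₂] = x₃`. -/
def HeisenbergLie (K : Type*) : Type _ := Fin 3 → K

namespace HeisenbergLie

variable (K : Type*) [Field K]

instance : AddCommGroup (HeisenbergLie K) := inferInstanceAs (AddCommGroup (Fin 3 → K))

instance : Module K (HeisenbergLie K) := inferInstanceAs (Module K (Fin 3 → K))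

/-- The bracket in coordinates. -/
def br (x y : Fin 3 → K) : Fin 3 → K := ![0, 0, x 0 * y 1 - x 1 * y 0]

instance : LieRing (HeisenbergLie K) where
  bracket x y := br K x y
  add_lie x y z := by
    change br K (fun i => x i + y i) z = fun i => br K x z i + br K y z i
    funext i; fin_cases i <;> simp [br] <;> ring
  lie_add x y z := by
    change br K x (fun i => y i + z i) = fun i => br K x y i + br K x z i
    funext i; fin_cases i <;> simp [br] <;> ring
  lie_self x := by
    change br K x x = fun _ => 0
    funext i; fin_cases i <;> simp [br] <;> ring
  leibniz_lie x y z := by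
    change br K x (br K y z) = fun i => br K (br K x y) z i + br K y (br K x z) i
    funext i; fin_cases i <;> simp [br]

instance : LieAlgebra K (HeisenbergLie K) where
  lie_smul t x y := by
    change br K x (fun i => t * y i) = fun i => t * br K x y i
    funext i; fin_cases i <;> simp [br] <;> ring

end HeisenbergLie

/-- The underlying space of the Lie algebra `L_{5,8}`: basis `x₁, …, x₅` (coordinates
`0, …, 4`), the only nonzero brackets of basis vectors, up to antisymmetry, being
`[x₁, x₂] = x₄` and `[x₁, x₃] = x₅`. -/
def LieL58 (K : Type*) : Type _ := Fin 5 → K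

namespace LieL58

variable (K : Type*) [Field K]

instance : AddCommGroup (LieL58 K) := inferInstanceAs (AddCommGroup (Fin 5 → K))

instance : Module K (LieL58 K) := inferInstanceAs (Module K (Fin 5 → K))

/-- The bracket in coordinates. -/
def br (x y : Fin 5 → K) : Fin 5 → K :=
  ![0, 0, 0, x 0 * y 1 - x 1 * y 0, x 0 * y 2 - x 2 * y 0]

instance : LieRing (LieL58 K) where
  bracket x y := br K x y
  add_lie x y z := by
    change br K (fun i => x i + y i) z = fun i => br K x z i + br K y z i
    funext i; fin_cases i <;> simp [br] <;> ring
  lie_add x y z := by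
    change br K x (fun i => y i + z i) = fun i => br K x y i + br K x z i
    funext i; fin_cases i <;> simp [br] <;> ring
  lie_self x := by
    change br K x x = fun _ => 0
    funext i; fin_cases i <;> simp [br] <;> ring
  leibniz_lie x y z := by
    change br K x (br K y z) = fun i => br K (br K x y) z i + br K y (br K x z) i
    funext i; fin_cases i <;> simp [br]

instance : LieAlgebra K (LieL58 K) where
  lie_smul t x y := by
    change br K x (fun i => t * y i) = fun i => t * br K x y i
    funext i; fin_cases i <;> simp [br] <;> ring

end LieL58

/-- The underlying space of the Lie algebra `L_{6,26}`: basis `x₁, …, x₆` (coordinates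
`0, …, 5`), the only nonzero brackets of basis vectors, up to antisymmetry, being
`[x₁, x₂] = x₄`, `[x₁, x₃] = x₅` and `[x₂, x₃] = x₆`. -/
def LieL626 (K : Type*) : Type _ := Fin 6 → K

namespace LieL626

variable (K : Type*) [Field K]

instance : AddCommGroup (LieL626 K) := inferInstanceAs (AddCommGroup (Fin 6 → K))

instance : Module K (LieL626 K) := inferInstanceAs (Module K (Fin 6 → K))

/-- The bracket in coordinates. -/
def br (x y : Fin 6 → K) : Fin 6 → K :=
  ![0, 0, 0, x 0 * y 1 - x 1 * y 0, x 0 * y 2 - x 2 * y 0, x 1 * y 2 - x 2 * y 1]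

instance : LieRing (LieL626 K) where
  bracket x y := br K x y
  add_lie x y z := by
    change br K (fun i => x i + y i) z = fun i => br K x z i + br K y z i
    funext i; fin_cases i <;> simp [br] <;> ring
  lie_add x y z := by
    change br K x (fun i => y i + z i) = fun i => br K x y i + br K x z i
    funext i; fin_cases i <;> simp [br] <;> ring
  lie_self x := by
    change br K x x = fun _ => 0
    funext i; fin_cases i <;> simp [br] <;> ring
  leibniz_lie x y z := by
    change br K x (br K y z) = fun i => br K (br K x y) z i + br K y (br K x z) i
    funext i; fin_cases i <;> simp [br]

instance : LieAlgebra K (LieL626 K) where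
  lie_smul t x y := by
    change br K x (fun i => t * y i) = fun i => t * br K x y i
    funext i; fin_cases i <;> simp [br] <;> ring

end LieL626

/-! Write W = L² and choose a linear complement V of W, of dimension d = n - m. Class two makes W
central, so the whole bracket is an alternating map β : V × V → W whose values span W. Everything is
governed by J, the span in W ⊗ V of the Jacobi elements of β (`jacobiSpan`).

The multiplier is the kernel of the surjection F²/[R,F] → L². Functionals on F²/[R,F] are exactly
the scalar 2-cocycles of L (`dualToCocycle_injective`, `dualToCocycle_surjective`). A cocycle
amounts to an arbitrary alternating form on V together with a functional on W ⊗ V vanishing on J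
(`cocycleRestrict_injective`, `cocycleRestrict_surjective`). Hence dim M(L) = C(d,2) + md - m - dim
J (`finrank_schurMultiplier`), and the bound is attained precisely when dim J = d - 2.

For β x y ≠ 0, reducing W ⊗ V modulo ⟨x, y⟩ in the second factor sends J onto a space containing β x
y ⊗ V/⟨x, y⟩, so dim J ≥ d - 2 always. If equality holds and d ≥ 4, this rigidity forces β to live
on ⟨x, y⟩ alone, which gives H(1) ⊕ A(n-3). For d ≤ 3 the remaining possibilities are sorted by m ≤
C(d,2). Conversely, on H(1) ⊕ A(k) the form β is a decomposable 2-form times a vector, and the other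
two algebras have d ≤ 3; both situations give dim J ≤ d - 2. -/

open scoped TensorProduct
open Module

/-! ### Alternating bilinear maps and the span of their Jacobi elements. -/

section LinearAlgebra

variable {K V W : Type*} [Field K] [AddCommGroup V] [Module K V] [AddCommGroup W] [Module K W]

/-- The space of alternating bilinear forms. -/
def altForms (K V : Type*) [Field K] [AddCommGroup V] [Module K V] :
    Submodule K (V →ₗ[K] V →ₗ[K] K) where
  carrier := {a | ∀ x, a x x = 0}
  add_mem' {a b} ha hb x := by simp [ha x, hb x]
  zero_mem' := by simp
  smul_mem' t {c} hc x := by simp [hc x]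

theorem apply_swap_of_apply_self {β : V →ₗ[K] V →ₗ[K] W} (hβ : ∀ v, β v v = 0) (x y : V) :
    β y x = -β x y := by
  have h := hβ (x + y)
  simp only [map_add, LinearMap.add_apply, hβ, zero_add, add_zero] at h
  exact eq_neg_of_add_eq_zero_left h

theorem vec2_update_zero {α : Type*} (x x' y : α) : Function.update ![x, y] 0 x' = ![x', y] := by
  ext i; fin_cases i <;> rfl

theorem vec2_update_one {α : Type*} (x y y' : α) : Function.update ![x, y] 1 y' = ![x, y'] := by
  ext i; fin_cases i <;> rfl

/-- Alternating bilinear forms as alternating maps on pairs. -/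
def altFormsEquivAlternatingMap (K V : Type*) [Field K] [AddCommGroup V] [Module K V] :
    altForms K V ≃ₗ[K] V [⋀^Fin 2]→ₗ[K] K where
  toFun a :=
    { toFun := fun v => a.1 (v 0) (v 1)
      map_update_add' := by
        intro _ v i x y
        fin_cases i <;> simp [Function.update]
      map_update_smul' := by
        intro _ v i c x
        fin_cases i <;> simp [Function.update]
      map_eq_zero_of_eq' := by
        intro v i j hv hij
        fin_cases i <;> fin_cases j <;> simp_all [a.2 _] }
  map_add' _ _ := by ext; rfl
  map_smul' _ _ := by ext; rfl
  invFun f :=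
    { val := LinearMap.mk₂ K (fun x y => f ![x, y])
        (fun x x' y => by
          have := f.map_update_add ![x, y] 0 x x'
          simpa only [vec2_update_zero] using this)
        (fun c x y => by
          have := f.map_update_smul ![x, y] 0 c x
          simpa only [vec2_update_zero] using this)
        (fun x y y' => by
          have := f.map_update_add ![x, y] 1 y y'
          simpa only [vec2_update_one] using this)
        (fun c x y => by
          have := f.map_update_smul ![x, y] 1 c y
          simpa only [vec2_update_one] using this)
      property := fun x => f.map_eq_zero_of_eq ![x, x] (i := 0) (j := 1) rfl (by simp) }
  left_inv a := by ext; rfl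
  right_inv f := by
    ext v
    change f ![v 0, v 1] = f v
    congr 1
    ext i
    fin_cases i <;> rfl

theorem finrank_altForms [FiniteDimensional K V] :
    finrank K (altForms K V) = (finrank K V).choose 2 := by
  rw [(altFormsEquivAlternatingMap K V ≪≫ₗ
    exteriorPower.alternatingMapLinearEquiv).finrank_eq]
  exact Subspace.dual_finrank_eq.trans (exteriorPower.finrank_eq K 2)

/-- The Jacobi element `β x y ⊗ z + β y z ⊗ x + β z x ⊗ y`. -/
def jacobiElement (β : V →ₗ[K] V →ₗ[K] W) (x y z : V) : W ⊗[K] V :=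
  β x y ⊗ₜ z + β y z ⊗ₜ x + β z x ⊗ₜ y

/-- The span of all Jacobi elements. -/
def jacobiSpan (β : V →ₗ[K] V →ₗ[K] W) : Submodule K (W ⊗[K] V) :=
  Submodule.span K {t | ∃ x y z, jacobiElement β x y z = t}

theorem jacobiElement_mem (β : V →ₗ[K] V →ₗ[K] W) (x y z : V) :
    jacobiElement β x y z ∈ jacobiSpan β :=
  Submodule.subset_span ⟨x, y, z, rfl⟩

/-- The Jacobi element as an alternating map. -/
def jacobiAlternating (β : V →ₗ[K] V →ₗ[K] W) (hβ : ∀ v, β v v = 0) :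
    V [⋀^Fin 3]→ₗ[K] W ⊗[K] V where
  toFun v := jacobiElement β (v 0) (v 1) (v 2)
  map_update_add' := by
    intro inst v i x y
    obtain rfl := Subsingleton.elim inst (instDecidableEqFin 3)
    obtain rfl | rfl | rfl : i = 0 ∨ i = 1 ∨ i = 2 := by omega
    all_goals
      simp [Function.update, jacobiElement, TensorProduct.add_tmul, TensorProduct.tmul_add]
      abel
  map_update_smul' := by
    intro inst v i c x
    obtain rfl := Subsingleton.elim inst (instDecidableEqFin 3)
    obtain rfl | rfl | rfl : i = 0 ∨ i = 1 ∨ i = 2 := by omega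
    all_goals
      simp [Function.update, jacobiElement, TensorProduct.smul_tmul']
  map_eq_zero_of_eq' := by
    intro v i j hv hij
    have h := apply_swap_of_apply_self hβ
    have h3 : v 0 = v 1 ∨ v 1 = v 2 ∨ v 0 = v 2 := by
      fin_cases i <;> fin_cases j <;>
        first
        | exact absurd rfl hij
        | exact Or.inl hv
        | exact Or.inl hv.symm
        | exact Or.inr (Or.inl hv)
        | exact Or.inr (Or.inl hv.symm)
        | exact Or.inr (Or.inr hv)
        | exact Or.inr (Or.inr hv.symm)
    rcases h3 with h3 | h3 | h3
    · rw [h3, jacobiElement, hβ, h (v 1) (v 2), TensorProduct.neg_tmul, TensorProduct.zero_tmul]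
      abel
    · rw [h3, jacobiElement, hβ, h (v 0) (v 2), TensorProduct.neg_tmul, TensorProduct.zero_tmul]
      abel
    · rw [h3, jacobiElement, hβ, h (v 1) (v 2), TensorProduct.neg_tmul, TensorProduct.zero_tmul]
      abel

/-- Jacobi elements are alternating in their three arguments, so their span is covered by the image
of Λ³V. The estimate is sharp enough to be useful when dim V ≤ 3. -/
theorem finrank_jacobiSpan_le_choose [FiniteDimensional K V] (β : V →ₗ[K] V →ₗ[K] W)
    (hβ : ∀ v, β v v = 0) : finrank K (jacobiSpan β) ≤ (finrank K V).choose 3 := by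
  set J := exteriorPower.alternatingMapLinearEquiv (jacobiAlternating β hβ)
  have h : jacobiSpan β ≤ LinearMap.range J := by
    refine Submodule.span_le.2 ?_
    rintro _ ⟨x, y, z, rfl⟩
    exact ⟨exteriorPower.ιMulti K 3 ![x, y, z],
      exteriorPower.alternatingMapLinearEquiv_apply_ιMulti _ _⟩
  refine (Submodule.finrank_mono h).trans ((LinearMap.finrank_range_le J).trans ?_)
  exact (exteriorPower.finrank_eq K 3).le

theorem linearIndependent_pair_of_apply_ne_zero {β : V →ₗ[K] V →ₗ[K] W}
    (hβ : ∀ v, β v v = 0) {x y : V} (h : β x y ≠ 0) : LinearIndependent K ![x, y] := by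
  rw [LinearIndependent.pair_iff]
  intro s t hst
  have h1 : β (s • x + t • y) y = 0 := by rw [hst]; simp
  have h2 : β x (s • x + t • y) = 0 := by rw [hst]; simp
  simp only [map_add, map_smul, LinearMap.add_apply, LinearMap.smul_apply, hβ, smul_zero,
    add_zero, zero_add, smul_eq_zero, h, or_false] at h1 h2
  exact ⟨h1, h2⟩

theorem finrank_span_pair_of_apply_ne_zero {β : V →ₗ[K] V →ₗ[K] W}
    (hβ : ∀ v, β v v = 0) {x y : V} (h : β x y ≠ 0) :
    finrank K (Submodule.span K {x, y}) = 2 := by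
  have := finrank_span_eq_card (linearIndependent_pair_of_apply_ne_zero hβ h)
  rwa [Matrix.range_cons_cons_empty] at this

theorem finrank_quotient_span_pair [FiniteDimensional K V] {β : V →ₗ[K] V →ₗ[K] W}
    (hβ : ∀ v, β v v = 0) {x y : V} (h : β x y ≠ 0) :
    finrank K (V ⧸ Submodule.span K {x, y}) + 2 = finrank K V := by
  rw [← finrank_span_pair_of_apply_ne_zero hβ h]
  exact Submodule.finrank_quotient_add_finrank _

/-- Tensoring on the left with a fixed nonzero vector is injective. -/
theorem mk_injective_of_ne_zero {w : W} (hw : w ≠ 0) :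
    Function.Injective (TensorProduct.mk K W V w) := by
  obtain ⟨f, hf⟩ := Module.Projective.exists_dual_eq_one K hw
  refine Function.LeftInverse.injective
    (g := (TensorProduct.lid K V).toLinearMap ∘ₗ f.rTensor V) fun v => ?_
  simp [hf]

/-- The map `W ⊗ V → W ⊗ (V / ⟨x, y⟩)`. -/
abbrev mkPairTensor (W : Type*) [AddCommGroup W] [Module K W] (x y : V) :
    W ⊗[K] V →ₗ[K] W ⊗[K] (V ⧸ Submodule.span K {x, y}) :=
  (Submodule.span K {x, y}).mkQ.lTensor W

/-- The two terms of the Jacobi element that end in x or y die modulo ⟨x, y⟩. This isolates a pure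
tensor and is the source of the lower bound for the Jacobi span. -/
theorem mkPairTensor_jacobiElement (β : V →ₗ[K] V →ₗ[K] W) (x y z : V) :
    mkPairTensor W x y (jacobiElement β x y z) = β x y ⊗ₜ Submodule.Quotient.mk z := by
  have hx : (Submodule.Quotient.mk x : V ⧸ Submodule.span K {x, y}) = 0 :=
    (Submodule.Quotient.mk_eq_zero _).2 (Submodule.subset_span (by simp))
  have hy : (Submodule.Quotient.mk y : V ⧸ Submodule.span K {x, y}) = 0 :=
    (Submodule.Quotient.mk_eq_zero _).2 (Submodule.subset_span (by simp))
  simp [jacobiElement, hx, hy]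

/-- The image of `V / ⟨x, y⟩` tensored with `β x y` lies in the image of the Jacobi span. -/
theorem range_mk_le_map_jacobiSpan (β : V →ₗ[K] V →ₗ[K] W) (x y : V) :
    LinearMap.range (TensorProduct.mk K W (V ⧸ Submodule.span K {x, y}) (β x y)) ≤
      (jacobiSpan β).map (mkPairTensor W x y) := by
  rintro _ ⟨v, rfl⟩
  obtain ⟨z, rfl⟩ := Submodule.Quotient.mk_surjective _ v
  exact ⟨_, jacobiElement_mem β x y z, mkPairTensor_jacobiElement β x y z⟩

/-- The common centralizer of `x` and `y`. -/
abbrev pairCentralizer (β : V →ₗ[K] V →ₗ[K] W) (x y : V) : Submodule K V :=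
  LinearMap.ker (β x) ⊓ LinearMap.ker (β y)

theorem isCompl_pairCentralizer {β : V →ₗ[K] V →ₗ[K] W}
    (hβ : ∀ v, β v v = 0) {x y : V} (h : β x y ≠ 0)
    (hx : ∀ z, β x z ∈ Submodule.span K {β x y}) (hy : ∀ z, β y z ∈ Submodule.span K {β x y}) :
    IsCompl (Submodule.span K {x, y}) (pairCentralizer β x y) := by
  have hs := apply_swap_of_apply_self hβ
  constructor
  · rw [Submodule.disjoint_def]
    intro v hv hc
    obtain ⟨a, b, rfl⟩ := Submodule.mem_span_pair.1 hv
    obtain ⟨h1, h2⟩ := hc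
    simp only [SetLike.mem_coe, LinearMap.mem_ker, map_add, map_smul, hβ, smul_zero, zero_add,
      add_zero, smul_eq_zero, h, or_false, hs x y, neg_eq_zero] at h1 h2
    simp [h1, h2]
  · rw [codisjoint_iff, Submodule.eq_top_iff']
    intro v
    obtain ⟨a, ha⟩ := Submodule.mem_span_singleton.1 (hx v)
    obtain ⟨b, hb⟩ := Submodule.mem_span_singleton.1 (hy v)
    -- With β x v = a β x y and β y v = b β x y, this is the vector of ⟨x, y⟩ that pairs with x and
    -- with y exactly as v does.
    refine Submodule.mem_sup.2 ⟨a • y - b • x, ?_, v - (a • y - b • x), ⟨?_, ?_⟩, by abel⟩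
    · exact sub_mem (Submodule.smul_mem _ _ (Submodule.subset_span (by simp)))
        (Submodule.smul_mem _ _ (Submodule.subset_span (by simp)))
    · simp [hβ, ha]
    · simp [hβ, hs x y, hb]

variable [FiniteDimensional K V]

theorem finrank_range_mk {β : V →ₗ[K] V →ₗ[K] W}
    (hβ : ∀ v, β v v = 0) {x y : V} (h : β x y ≠ 0) :
    finrank K (LinearMap.range (TensorProduct.mk K W (V ⧸ Submodule.span K {x, y}) (β x y))) + 2 =
      finrank K V := by
  rw [LinearMap.finrank_range_of_inj (mk_injective_of_ne_zero h), finrank_quotient_span_pair hβ h]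

/-- For a bracket of the form `(α₁ ∧ α₂) ⊗ w` the Jacobi span has dimension at most
`dim V - 2`. -/
theorem finrank_jacobiSpan_add_two_le {β : V →ₗ[K] V →ₗ[K] W}
    (hβ : ∀ v, β v v = 0) {x y : V} (h : β x y ≠ 0) (α₁ α₂ : V →ₗ[K] K) (w : W)
    (hw : ∀ a b, β a b = (α₁ a * α₂ b - α₂ a * α₁ b) • w) :
    finrank K (jacobiSpan β) + 2 ≤ finrank K V := by
  set C := LinearMap.ker α₁ ⊓ LinearMap.ker α₂
  have hN : jacobiSpan β ≤ C.map (TensorProduct.mk K W V w) := by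
    refine Submodule.span_le.2 ?_
    rintro _ ⟨a, b, c, rfl⟩
    -- The contraction of α₁ ∧ α₂ with a, b, c. Applying α₁ or α₂ to it gives a 3 × 3 determinant
    -- with a repeated row, so it lies in both kernels.
    refine ⟨(α₁ a * α₂ b - α₂ a * α₁ b) • c + (α₁ b * α₂ c - α₂ b * α₁ c) • a +
      (α₁ c * α₂ a - α₂ c * α₁ a) • b, ⟨?_, ?_⟩, ?_⟩
    · simp; ring
    · simp; ring
    · simp only [TensorProduct.mk_apply, jacobiElement, hw, TensorProduct.tmul_add,
        TensorProduct.tmul_smul, TensorProduct.smul_tmul']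
  have hC : Disjoint (Submodule.span K {x, y}) C := by
    rw [Submodule.disjoint_def]
    intro v hv hc
    obtain ⟨a, b, rfl⟩ := Submodule.mem_span_pair.1 hv
    have h1 : α₁ (a • x + b • y) = 0 := hc.1
    have h2 : α₂ (a • x + b • y) = 0 := hc.2
    have e1 : β (a • x + b • y) y = 0 := by rw [hw, h1, h2]; simp
    have e2 : β x (a • x + b • y) = 0 := by rw [hw, h1, h2]; simp
    simp only [map_add, map_smul, LinearMap.add_apply, LinearMap.smul_apply, hβ, smul_zero,
      add_zero, zero_add, smul_eq_zero, h, or_false] at e1 e2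
    simp [e1, e2]
  have h1 := Submodule.finrank_mono hN
  have h2 := Submodule.finrank_map_le (TensorProduct.mk K W V w) C
  have h3 := Submodule.finrank_add_finrank_le_of_disjoint hC
  rw [finrank_span_pair_of_apply_ne_zero hβ h] at h3
  omega

variable [FiniteDimensional K W]

theorem finrank_le_finrank_jacobiSpan_add_two {β : V →ₗ[K] V →ₗ[K] W}
    (hβ : ∀ v, β v v = 0) {x y : V} (h : β x y ≠ 0) :
    finrank K V ≤ finrank K (jacobiSpan β) + 2 := by
  rw [← finrank_range_mk hβ h]
  have h1 := Submodule.finrank_mono (range_mk_le_map_jacobiSpan β x y)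
  have h2 := Submodule.finrank_map_le (mkPairTensor W x y) (jacobiSpan β)
  omega

/-- When the Jacobi span has the least possible dimension, it is mapped isomorphically
to the pure tensors `β x y ⊗ v`. -/
theorem map_jacobiSpan_eq {β : V →ₗ[K] V →ₗ[K] W}
    (hβ : ∀ v, β v v = 0) {x y : V} (h : β x y ≠ 0)
    (hr : finrank K (jacobiSpan β) + 2 = finrank K V) :
    LinearMap.range (TensorProduct.mk K W (V ⧸ Submodule.span K {x, y}) (β x y)) =
      (jacobiSpan β).map (mkPairTensor W x y) := by
  refine Submodule.eq_of_le_of_finrank_le (range_mk_le_map_jacobiSpan β x y) ?_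
  have h2 := Submodule.finrank_map_le (mkPairTensor W x y) (jacobiSpan β)
  have h1 := finrank_range_mk hβ h
  omega

/-- The image of the Jacobi span modulo ⟨x, y⟩ already has dimension dim V - 2, so in the extremal
case the reduction is injective on the span. -/
theorem eq_zero_of_mem_jacobiSpan {β : V →ₗ[K] V →ₗ[K] W}
    (hβ : ∀ v, β v v = 0) {x y : V} (h : β x y ≠ 0)
    (hr : finrank K (jacobiSpan β) + 2 = finrank K V) {t : W ⊗[K] V} (ht : t ∈ jacobiSpan β)
    (h0 : mkPairTensor W x y t = 0) : t = 0 := by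
  have h1 := finrank_range_mk hβ h
  rw [map_jacobiSpan_eq hβ h hr, ← LinearMap.range_domRestrict] at h1
  have h2 := LinearMap.finrank_range_add_finrank_ker
    ((mkPairTensor W x y).domRestrict (jacobiSpan β))
  have h3 : finrank K (LinearMap.ker ((mkPairTensor W x y).domRestrict (jacobiSpan β))) = 0 := by
    omega
  rw [Submodule.finrank_eq_zero] at h3
  have h4 : (⟨t, ht⟩ : jacobiSpan β) ∈
      LinearMap.ker ((mkPairTensor W x y).domRestrict (jacobiSpan β)) := h0
  rw [h3, Submodule.mem_bot] at h4
  exact congrArg Subtype.val h4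

/-- Otherwise some functional f kills β x y but not β x z. In the extremal case the Jacobi element
of x, z, u reduces to a multiple β x y ⊗ v, which f annihilates; this reads f(β x z) u + f(β u x) z
= 0 modulo ⟨x, y⟩. So z spans V/⟨x, y⟩, which is impossible when dim V ≥ 4. -/
theorem apply_left_mem_span_of_finrank_jacobiSpan {β : V →ₗ[K] V →ₗ[K] W}
    (hβ : ∀ v, β v v = 0) {x y : V} (h : β x y ≠ 0)
    (hr : finrank K (jacobiSpan β) + 2 = finrank K V) (hd : 4 ≤ finrank K V) (z : V) :
    β x z ∈ Submodule.span K {β x y} := by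
  by_contra hz
  obtain ⟨f, hf, hf0⟩ := Submodule.exists_le_ker_of_notMem hz
  have hfw : f (β x y) = 0 := hf0 (Submodule.mem_span_singleton_self _)
  have hx : (Submodule.Quotient.mk x : V ⧸ Submodule.span K {x, y}) = 0 :=
    (Submodule.Quotient.mk_eq_zero _).2 (Submodule.subset_span (by simp))
  have key : ∀ v : V ⧸ Submodule.span K {x, y}, ∃ c : K, c • Submodule.Quotient.mk z = v := by
    intro v
    obtain ⟨u, rfl⟩ := Submodule.Quotient.mk_surjective _ v
    have hm : mkPairTensor W x y (jacobiElement β x z u) ∈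
        (jacobiSpan β).map (mkPairTensor W x y) := ⟨_, jacobiElement_mem β x z u, rfl⟩
    rw [← map_jacobiSpan_eq hβ h hr] at hm
    obtain ⟨v, hv⟩ := hm
    have hv' := congrArg ((TensorProduct.lid K _).toLinearMap ∘ₗ f.rTensor _) hv
    simp only [jacobiElement, map_add, LinearMap.coe_comp, Function.comp_apply,
      LinearMap.rTensor_tmul, LinearMap.lTensor_tmul, TensorProduct.mk_apply, hfw,
      LinearEquiv.coe_coe, TensorProduct.lid_tmul, zero_smul, Submodule.mkQ_apply, hx,
      smul_zero, add_zero] at hv'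
    refine ⟨-(f (β x z))⁻¹ * f (β u x), ?_⟩
    have h5 := eq_neg_of_add_eq_zero_left hv'.symm
    rw [mul_smul, neg_smul, ← smul_neg, ← h5, smul_smul, inv_mul_cancel₀ hf, one_smul]
  have h6 := finrank_le_one _ key
  have h7 := finrank_quotient_span_pair hβ h
  omega

/-- If the Jacobi span has the least possible dimension `dim V - 2` and `dim V ≥ 4`, then the
bracket is supported on any noncommuting pair. -/
theorem isCompl_pairCentralizer_of_finrank_jacobiSpan {β : V →ₗ[K] V →ₗ[K] W}
    (hβ : ∀ v, β v v = 0) {x y : V} (h : β x y ≠ 0)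
    (hr : finrank K (jacobiSpan β) + 2 = finrank K V) (hd : 4 ≤ finrank K V) :
    IsCompl (Submodule.span K {x, y}) (pairCentralizer β x y) ∧
      ∀ c ∈ pairCentralizer β x y, ∀ c' ∈ pairCentralizer β x y, β c c' = 0 := by
  have hs := apply_swap_of_apply_self hβ
  refine ⟨isCompl_pairCentralizer hβ h
    (apply_left_mem_span_of_finrank_jacobiSpan hβ h hr hd) fun z => ?_, fun c hc c' hc' => ?_⟩
  · have h' : β y x ≠ 0 := by rwa [hs x y, neg_ne_zero]
    have := apply_left_mem_span_of_finrank_jacobiSpan hβ h' hr hd z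
    rwa [hs x y, ← Set.neg_singleton, Submodule.span_neg] at this
  · have h1 : β x c = 0 := hc.1
    have h2 : β x c' = 0 := hc'.1
    have hJ : jacobiElement β x c c' = β c c' ⊗ₜ x := by
      simp [jacobiElement, h1, hs x c', h2]
    have hx : (Submodule.Quotient.mk x : V ⧸ Submodule.span K {x, y}) = 0 :=
      (Submodule.Quotient.mk_eq_zero _).2 (Submodule.subset_span (by simp))
    -- The Jacobi element of x, c, c' collapses to β c c' ⊗ x, which vanishes modulo ⟨x, y⟩ and is
    -- therefore zero in the extremal case.
    have h0 := eq_zero_of_mem_jacobiSpan hβ h hr (jacobiElement_mem β x c c')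
      (by rw [hJ]; simp [hx])
    rw [hJ] at h0
    by_contra hne
    have hx0 : x = 0 := mk_injective_of_ne_zero (K := K) (V := V) hne (by simpa using h0)
    exact h (by simp [hx0])

end LinearAlgebra

/-! ### Scalar 2-cocycles in terms of a complement of the derived subalgebra. -/

section Cocycles

variable (K L : Type*) [Field K] [LieRing L] [LieAlgebra K L]

/-- The derived subalgebra as a submodule. -/
abbrev derivedSubmodule : Submodule K L :=
  (⁅(⊤ : LieIdeal K L), (⊤ : LieIdeal K L)⁆ : LieIdeal K L).toSubmodule

theorem lie_mem_derivedSubmodule (x y : L) : ⁅x, y⁆ ∈ derivedSubmodule K L :=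
  LieSubmodule.lie_mem_lie (LieSubmodule.mem_top x) (LieSubmodule.mem_top y)

theorem derivedSubmodule_eq_span :
    derivedSubmodule K L = Submodule.span K {t | ∃ x y : L, ⁅x, y⁆ = t} := by
  rw [derivedSubmodule, LieSubmodule.lieIdeal_oper_eq_linear_span']
  simp

/-- The scalar 2-cocycles of a Lie algebra, for the trivial action. -/
def scalarCocycles : Submodule K (L →ₗ[K] L →ₗ[K] K) where
  carrier := {f | (∀ x, f x x = 0) ∧ ∀ x y z, f ⁅x, y⁆ z + f ⁅y, z⁆ x + f ⁅z, x⁆ y = 0}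
  add_mem' {a b} ha hb := by
    refine ⟨fun x => by simp [ha.1 x, hb.1 x], fun x y z => ?_⟩
    have h1 := ha.2 x y z
    have h2 := hb.2 x y z
    simp only [LinearMap.add_apply]
    linear_combination h1 + h2
  zero_mem' := by simp
  smul_mem' t {c} hc := by
    refine ⟨fun x => by simp [hc.1 x], fun x y z => ?_⟩
    have h1 := hc.2 x y z
    simp only [LinearMap.smul_apply, smul_eq_mul]
    linear_combination t * h1

variable {K L}

/-- The Lie bracket of elements of a submodule, as a bilinear map to the derived subalgebra. -/
def bracketOn (V : Submodule K L) : V →ₗ[K] V →ₗ[K] derivedSubmodule K L :=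
  LinearMap.mk₂ K (fun x y => ⟨⁅(x : L), (y : L)⁆, lie_mem_derivedSubmodule K L _ _⟩)
    (fun _ _ _ => Subtype.ext (by simp)) (fun _ _ _ => Subtype.ext (by simp))
    (fun _ _ _ => Subtype.ext (by simp)) (fun _ _ _ => Subtype.ext (by simp))

theorem bracketOn_self (V : Submodule K L) (x : V) : bracketOn V x x = 0 :=
  Subtype.ext (lie_self _)

variable (hc : ∀ w ∈ derivedSubmodule K L, ∀ l : L, ⁅w, l⁆ = 0)
  {V : Submodule K L} (hV : IsCompl V (derivedSubmodule K L))

include hc in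
theorem lie_eq_lie_projection (x y : L) :
    ⁅x, y⁆ = ⁅(V.projectionOnto _ hV x : L), (V.projectionOnto _ hV y : L)⁆ := by
  have h (x : L) : ∃ w ∈ derivedSubmodule K L, x = V.projectionOnto _ hV x + w :=
    ⟨x - V.projectionOnto _ hV x, Submodule.sub_projection_mem hV x, by abel⟩
  have h' (w) (hw : w ∈ derivedSubmodule K L) (l : L) : ⁅l, w⁆ = 0 := by
    rw [← lie_skew, hc w hw, neg_zero]
  obtain ⟨w, hw, hx⟩ := h x
  obtain ⟨w', hw', hy⟩ := h y
  conv_lhs => rw [hx, hy]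
  simp [hc w hw, h' w' hw']

theorem projectionOnto_lie (x y : L) : V.projectionOnto _ hV ⁅x, y⁆ = 0 :=
  (Submodule.projectionOnto_apply_eq_zero_iff hV).2 (lie_mem_derivedSubmodule K L x y)

/-- Restriction of a cocycle to a complement `V` of the derived subalgebra `W`, and to `W ⊗ V`. -/
def cocycleRestrict (V : Submodule K L) : scalarCocycles K L →ₗ[K]
    altForms K V × (jacobiSpan (bracketOn V)).dualAnnihilator where
  toFun f := (⟨f.1.domRestrict₁₂ V V, fun x => f.2.1 x⟩,
    ⟨TensorProduct.lift (f.1.domRestrict₁₂ (derivedSubmodule K L) V), by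
      rw [Submodule.mem_dualAnnihilator]
      refine fun t ht => Submodule.span_le (p := LinearMap.ker _).2 ?_ ht
      rintro _ ⟨x, y, z, rfl⟩
      simp only [SetLike.mem_coe, LinearMap.mem_ker, jacobiElement, map_add,
        TensorProduct.lift.tmul]
      exact f.2.2 x y z⟩)
  map_add' f g := by
    refine Prod.ext (Subtype.ext ?_) (Subtype.ext ?_)
    · rfl
    · ext; rfl
  map_smul' c f := by
    refine Prod.ext (Subtype.ext ?_) (Subtype.ext ?_)
    · rfl
    · ext; rfl

-- The V × V and W × V blocks are recorded and the V × W block follows by skew symmetry. The W × W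
-- block is zero: in the cocycle identity for x, y, w' with w' central, only f([x, y], w') survives.
include hc hV in
theorem cocycleRestrict_injective : Function.Injective (cocycleRestrict (K := K) V) := by
  intro f g hfg
  have h1 : ∀ v v' : V, f.1 v v' = g.1 v v' := fun v v' =>
    LinearMap.congr_fun (LinearMap.congr_fun (congrArg (fun p => p.1.1) hfg) v) v'
  have h2 : ∀ (w : derivedSubmodule K L) (v : V), f.1 w v = g.1 w v := fun w v =>
    LinearMap.congr_fun (congrArg (fun p => p.2.1) hfg) (w ⊗ₜ v)
  have hs (f : scalarCocycles K L) := apply_swap_of_apply_self f.2.1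
  have h3 : ∀ f : scalarCocycles K L, ∀ w ∈ derivedSubmodule K L,
      ∀ w' ∈ derivedSubmodule K L, f.1 w w' = 0 := by
    intro f w hw w' hw'
    rw [derivedSubmodule_eq_span] at hw
    refine Submodule.span_le (p := LinearMap.ker (f.1.flip w')).2 ?_ hw
    rintro _ ⟨x, y, rfl⟩
    have := f.2.2 x y w'
    have e : ⁅y, w'⁆ = 0 := by rw [← lie_skew, hc w' hw', neg_zero]
    simpa [hc w' hw', e] using this
  refine Subtype.ext (LinearMap.ext fun x => LinearMap.ext fun y => ?_)
  have h (x : L) : ∃ v ∈ V, ∃ w ∈ derivedSubmodule K L, v + w = x :=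
    Submodule.mem_sup.1 (hV.sup_eq_top ▸ Submodule.mem_top)
  obtain ⟨v, hv, w, hw, rfl⟩ := h x
  obtain ⟨v', hv', w', hw', rfl⟩ := h y
  have e1 := h1 ⟨v, hv⟩ ⟨v', hv'⟩
  have e2 := h2 ⟨w, hw⟩ ⟨v', hv'⟩
  have e3 := h2 ⟨w', hw'⟩ ⟨v, hv⟩
  simp only at e1 e2 e3
  simp [e1, e2, hs _ w' v, e3, h3 _ w hw w' hw']

-- With p and q the projections to V and W, the preimage is a(px, py) + l(qx ⊗ py) - l(qy ⊗ px).
-- Since p kills brackets and q[x, y] is the bracket of px and py, the cocycle identity becomes the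
-- vanishing of l on one Jacobi element.
include hc hV in
theorem cocycleRestrict_surjective : Function.Surjective (cocycleRestrict (K := K) V) := by
  rintro ⟨⟨a, ha⟩, ⟨l, hl⟩⟩
  set p := V.projectionOnto _ hV
  set q := (derivedSubmodule K L).projectionOnto _ hV.symm
  set b : L →ₗ[K] L →ₗ[K] K := (TensorProduct.curry l).compl₁₂ q p
  have hpv (v : V) : p v = v := Submodule.projectionOnto_apply_left hV v
  have hpw (w : derivedSubmodule K L) : p w = 0 := Submodule.projectionOnto_apply_right hV w
  have hqv (v : V) : q v = 0 := Submodule.projectionOnto_apply_right hV.symm v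
  have hqw (w : derivedSubmodule K L) : q w = w :=
    Submodule.projectionOnto_apply_left hV.symm w
  have hbr (x y : L) : q ⁅x, y⁆ = bracketOn V (p x) (p y) := by
    rw [lie_eq_lie_projection hc hV x y]
    exact hqw (bracketOn V (p x) (p y))
  refine ⟨⟨a.compl₁₂ p p + b - b.flip, fun x => ?_, fun x y z => ?_⟩, ?_⟩
  · simp [ha _]
  · have h := (Submodule.mem_dualAnnihilator l).1 hl _
      (jacobiElement_mem (bracketOn V) (p x) (p y) (p z))
    have e (x y : L) : p ⁅x, y⁆ = 0 := projectionOnto_lie hV x y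
    simpa [b, e, hbr, jacobiElement] using h
  · refine Prod.ext (Subtype.ext ?_) (Subtype.ext ?_)
    · ext v v'
      change a (p v) (p v') + l (q v ⊗ₜ p v') - l (q v' ⊗ₜ p v) = a v v'
      simp [hpv, hqv]
    · ext w v
      change a (p w) (p v) + l (q w ⊗ₜ p v) - l (q v ⊗ₜ p w) = l (w ⊗ₜ v)
      simp [hpv, hqv, hpw, hqw]

include hc hV in
theorem finite_scalarCocycles [FiniteDimensional K L] : Module.Finite K (scalarCocycles K L) := by
  have : Module.Finite K (altForms K V) := Module.Finite.equiv
    (altFormsEquivAlternatingMap K V ≪≫ₗ exteriorPower.alternatingMapLinearEquiv).symm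
  have : Module.Finite K (jacobiSpan (bracketOn V)).dualAnnihilator :=
    Module.Finite.equiv (jacobiSpan (bracketOn V)).dualQuotEquivDualAnnihilator
  exact Module.Finite.equiv (LinearEquiv.ofBijective (cocycleRestrict V)
    ⟨cocycleRestrict_injective hc hV, cocycleRestrict_surjective hc hV⟩).symm

include hc hV in
theorem finrank_scalarCocycles [FiniteDimensional K L] :
    finrank K (scalarCocycles K L) + finrank K (jacobiSpan (bracketOn V)) =
      (finrank K V).choose 2 + finrank K (derivedSubmodule K L) * finrank K V := by
  have e₁ := altFormsEquivAlternatingMap K V ≪≫ₗ exteriorPower.alternatingMapLinearEquiv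
  have e₂ := (jacobiSpan (bracketOn V)).dualQuotEquivDualAnnihilator
  have : Module.Free K (altForms K V) := Module.Free.of_equiv e₁.symm
  have : Module.Finite K (altForms K V) := Module.Finite.equiv e₁.symm
  have : Module.Free K (jacobiSpan (bracketOn V)).dualAnnihilator := Module.Free.of_equiv e₂
  have : Module.Finite K (jacobiSpan (bracketOn V)).dualAnnihilator := Module.Finite.equiv e₂
  rw [(LinearEquiv.ofBijective (cocycleRestrict V) ⟨cocycleRestrict_injective hc hV,
    cocycleRestrict_surjective hc hV⟩).finrank_eq, finrank_prod, finrank_altForms, add_assoc,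
    add_comm (finrank K _) (finrank K (jacobiSpan _)),
    Subspace.finrank_add_finrank_dualAnnihilator_eq, finrank_tensorProduct]

end Cocycles

/-! ### One-dimensional central extensions attached to cocycles. -/

section Extension

variable {K L : Type*} [Field K] [LieRing L] [LieAlgebra K L]

/-- The central extension of `L` by the ground field given by a cocycle. -/
def CentralExtension (_f : scalarCocycles K L) : Type _ := L × K

namespace CentralExtension

variable (f : scalarCocycles K L)

instance : AddCommGroup (CentralExtension f) := inferInstanceAs (AddCommGroup (L × K))

instance : Module K (CentralExtension f) := inferInstanceAs (Module K (L × K))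

instance : LieRing (CentralExtension f) where
  bracket x y := ((⁅x.1, y.1⁆, f.1 x.1 y.1) : L × K)
  add_lie x y z := by
    change ((_, _) : L × K) = (_, _) + (_, _)
    refine Prod.ext (add_lie x.1 y.1 z.1) ?_
    change f.1 (x.1 + y.1) z.1 = f.1 x.1 z.1 + f.1 y.1 z.1
    simp
  lie_add x y z := by
    change ((_, _) : L × K) = (_, _) + (_, _)
    refine Prod.ext (lie_add x.1 y.1 z.1) ?_
    change f.1 x.1 (y.1 + z.1) = f.1 x.1 y.1 + f.1 x.1 z.1
    simp
  lie_self x := by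
    change ((⁅x.1, x.1⁆, f.1 x.1 x.1) : L × K) = 0
    simp [f.2.1]
  leibniz_lie x y z := by
    change ((⁅x.1, ⁅y.1, z.1⁆⁆, f.1 x.1 ⁅y.1, z.1⁆) : L × K) =
      (⁅⁅x.1, y.1⁆, z.1⁆, f.1 ⁅x.1, y.1⁆ z.1) + (⁅y.1, ⁅x.1, z.1⁆⁆, f.1 y.1 ⁅x.1, z.1⁆)
    refine Prod.ext (leibniz_lie x.1 y.1 z.1) ?_
    have h := f.2.2 x.1 y.1 z.1
    have hs := apply_swap_of_apply_self f.2.1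
    have e : f.1 ⁅z.1, x.1⁆ y.1 = f.1 y.1 ⁅x.1, z.1⁆ := by
      rw [hs y.1, ← lie_skew, map_neg, neg_neg]
    rw [hs x.1 ⁅y.1, z.1⁆, e] at h
    change f.1 x.1 ⁅y.1, z.1⁆ = f.1 ⁅x.1, y.1⁆ z.1 + f.1 y.1 ⁅x.1, z.1⁆
    linear_combination -h

instance : LieAlgebra K (CentralExtension f) where
  lie_smul t x y := by
    change ((⁅x.1, t • y.1⁆, f.1 x.1 (t • y.1)) : L × K) = t • (⁅x.1, y.1⁆, f.1 x.1 y.1)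
    simp

/-- The projection onto `L`. -/
def fst : CentralExtension f →ₗ⁅K⁆ L where
  toFun x := x.1
  map_add' _ _ := rfl
  map_smul' _ _ := rfl
  map_lie' := rfl

/-- The projection onto the ground field. -/
def snd : CentralExtension f →ₗ[K] K where
  toFun x := x.2
  map_add' _ _ := rfl
  map_smul' _ _ := rfl

/-- The element with given projections. -/
def mk (x : L) (t : K) : CentralExtension f := (x, t)

theorem fst_mk (x : L) (t : K) : fst f (mk f x t) = x := rfl

theorem snd_lie (x y : CentralExtension f) : snd f ⁅x, y⁆ = f.1 (fst f x) (fst f y) := rfl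

end CentralExtension

end Extension

/-! ### The Schur multiplier through functionals on F²/[R,F]. -/

section Multiplier

variable {K L X : Type*} [Field K] [LieRing L] [LieAlgebra K L]
  (π : FreeLieAlgebra K X →ₗ⁅K⁆ L)

/-- The submodule `[R, F]`, for `R` the kernel of a presentation. -/
noncomputable abbrev kernelCommutators : Submodule K (FreeLieAlgebra K X) :=
  (⁅π.ker, (⊤ : LieIdeal K (FreeLieAlgebra K X))⁆ : LieIdeal K _).toSubmodule

theorem lie_mem_kernelCommutators {r : FreeLieAlgebra K X} (hr : π r = 0)
    (a : FreeLieAlgebra K X) : ⁅r, a⁆ ∈ kernelCommutators π :=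
  LieSubmodule.lie_mem_lie (LieHom.mem_ker.2 hr) (LieSubmodule.mem_top a)

theorem lie_mem_kernelCommutators' {r : FreeLieAlgebra K X} (hr : π r = 0)
    (a : FreeLieAlgebra K X) : ⁅a, r⁆ ∈ kernelCommutators π := by
  rw [← lie_skew]
  exact neg_mem (lie_mem_kernelCommutators π hr a)

/-- The derived subalgebra `F² / [R, F]` of the universal central extension `F / [R, F]`. -/
abbrev DerivedQuotient : Type _ :=
  derivedSubmodule K (FreeLieAlgebra K X) ⧸
    (kernelCommutators π).comap (derivedSubmodule K (FreeLieAlgebra K X)).subtype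

/-- The commutator map with values in `F² / [R, F]`. -/
noncomputable def commutatorMap :
    FreeLieAlgebra K X →ₗ[K] FreeLieAlgebra K X →ₗ[K] DerivedQuotient π :=
  (LinearMap.mk₂ K
    (fun x y => (⟨⁅x, y⁆, lie_mem_derivedSubmodule K _ _ _⟩ :
      derivedSubmodule K (FreeLieAlgebra K X)))
    (fun _ _ _ => Subtype.ext (by simp)) (fun _ _ _ => Subtype.ext (by simp))
    (fun _ _ _ => Subtype.ext (by simp)) (fun _ _ _ => Subtype.ext (by simp))).compr₂
    (Submodule.mkQ _)

theorem commutatorMap_apply (a b : FreeLieAlgebra K X) :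
    commutatorMap π a b =
      Submodule.Quotient.mk ⟨⁅a, b⁆, lie_mem_derivedSubmodule K _ _ _⟩ := rfl

theorem commutatorMap_self (a : FreeLieAlgebra K X) : commutatorMap π a a = 0 := by
  rw [commutatorMap_apply, Submodule.Quotient.mk_eq_zero]
  simp

theorem commutatorMap_jacobi (a b c : FreeLieAlgebra K X) :
    commutatorMap π ⁅a, b⁆ c + commutatorMap π ⁅b, c⁆ a + commutatorMap π ⁅c, a⁆ b = 0 := by
  simp only [commutatorMap_apply, ← Submodule.Quotient.mk_add, Submodule.Quotient.mk_eq_zero]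
  have h := lie_jacobi a b c
  have e : ⁅⁅a, b⁆, c⁆ + ⁅⁅b, c⁆, a⁆ + ⁅⁅c, a⁆, b⁆ = 0 := by
    rw [← lie_skew ⁅a, b⁆, ← lie_skew ⁅b, c⁆, ← lie_skew ⁅c, a⁆, ← neg_eq_zero, ← h]
    abel
  change ⁅⁅a, b⁆, c⁆ + ⁅⁅b, c⁆, a⁆ + ⁅⁅c, a⁆, b⁆ ∈ kernelCommutators π
  rw [e]
  exact zero_mem _

/-- Changing an argument by an element of R changes the commutator by an element of [R,F]. The
commutator thus descends to L, and a merely linear section of π suffices to evaluate it there. -/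
theorem commutatorMap_congr {a a' b b' : FreeLieAlgebra K X} (ha : π a = π a') (hb : π b = π b') :
    commutatorMap π a b = commutatorMap π a' b' := by
  rw [commutatorMap_apply, commutatorMap_apply, Submodule.Quotient.eq]
  have e : ⁅a, b⁆ - ⁅a', b'⁆ = ⁅a - a', b⁆ + ⁅a', b - b'⁆ := by
    simp
  change ⁅a, b⁆ - ⁅a', b'⁆ ∈ kernelCommutators π
  rw [e]
  exact add_mem (lie_mem_kernelCommutators π (by simp [ha]) _)
    (lie_mem_kernelCommutators' π (by simp [hb]) _)

theorem ext_commutatorMap {M : Type*} [AddCommMonoid M] [Module K M]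
    {f g : DerivedQuotient π →ₗ[K] M}
    (h : ∀ a b, f (commutatorMap π a b) = g (commutatorMap π a b)) : f = g := by
  refine LinearMap.ext fun q => ?_
  obtain ⟨⟨t, ht⟩, rfl⟩ := Submodule.Quotient.mk_surjective _ q
  have ht' := ht
  rw [derivedSubmodule_eq_span] at ht'
  induction ht' using Submodule.span_induction with
  | mem x hx =>
    obtain ⟨a, b, rfl⟩ := hx
    exact h a b
  | zero =>
    have e : (Submodule.Quotient.mk ⟨0, ht⟩ : DerivedQuotient π) = 0 := rfl
    rw [e, map_zero, map_zero]
  | add x y hx hy h1 h2 =>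
    rw [← derivedSubmodule_eq_span] at hx hy
    have e : (Submodule.Quotient.mk ⟨x + y, ht⟩ : DerivedQuotient π) =
      Submodule.Quotient.mk ⟨x, hx⟩ + Submodule.Quotient.mk ⟨y, hy⟩ := rfl
    rw [e, map_add, map_add, h1 hx, h2 hy]
  | smul c x hx h1 =>
    rw [← derivedSubmodule_eq_span] at hx
    have e : (Submodule.Quotient.mk ⟨c • x, ht⟩ : DerivedQuotient π) =
      c • Submodule.Quotient.mk ⟨x, hx⟩ := rfl
    rw [e, map_smul, map_smul, h1 hx]

/-- A functional on `F² / [R, F]` gives a cocycle on `L`, by means of a linear section. -/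
noncomputable def dualToCocycle {s : L →ₗ[K] FreeLieAlgebra K X} (hs : ∀ x, π (s x) = x) :
    Dual K (DerivedQuotient π) →ₗ[K] scalarCocycles K L where
  toFun l := ⟨((commutatorMap π).compl₁₂ s s).compr₂ l, fun x => by
      simp [commutatorMap_self], fun x y z => by
      have e (x y z : L) : commutatorMap π (s ⁅x, y⁆) (s z) =
          commutatorMap π ⁅s x, s y⁆ (s z) := commutatorMap_congr π (by simp [hs]) rfl
      simp only [LinearMap.compr₂_apply, LinearMap.compl₁₂_apply, e, ← map_add,
        commutatorMap_jacobi, map_zero]⟩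
  map_add' _ _ := rfl
  map_smul' _ _ := rfl

theorem dualToCocycle_apply {s : L →ₗ[K] FreeLieAlgebra K X} (hs : ∀ x, π (s x) = x)
    (l : Dual K (DerivedQuotient π)) (x y : L) :
    (dualToCocycle π hs l).1 x y = l (commutatorMap π (s x) (s y)) := rfl

theorem dualToCocycle_injective {s : L →ₗ[K] FreeLieAlgebra K X} (hs : ∀ x, π (s x) = x) :
    Function.Injective (dualToCocycle π hs) := by
  intro l l' h
  refine ext_commutatorMap π fun a b => ?_
  have e : commutatorMap π a b = commutatorMap π (s (π a)) (s (π b)) :=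
    commutatorMap_congr π (hs _).symm (hs _).symm
  rw [e, ← dualToCocycle_apply π hs, h, dualToCocycle_apply]

/-- Freeness lifts π to the central extension defined by f. The K-component ψ of the lift satisfies
ψ[a, b] = f(πa, πb), so it kills [R,F] and induces the required functional on F²/[R,F]. -/
theorem dualToCocycle_surjective {s : L →ₗ[K] FreeLieAlgebra K X} (hs : ∀ x, π (s x) = x) :
    Function.Surjective (dualToCocycle π hs) := by
  intro f
  -- The K-coordinate of the generators is irrelevant, since only values on commutators matter; it
  -- is taken to be 0.
  set φ : FreeLieAlgebra K X →ₗ⁅K⁆ CentralExtension f :=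
    FreeLieAlgebra.lift K fun x => CentralExtension.mk f (π (FreeLieAlgebra.of K x)) 0
  have hφ : (CentralExtension.fst f).comp φ = π := by
    refine FreeLieAlgebra.hom_ext fun x => ?_
    change CentralExtension.fst f (FreeLieAlgebra.lift K _ (FreeLieAlgebra.of K x)) = _
    rw [FreeLieAlgebra.lift_of_apply, CentralExtension.fst_mk]
  have hφ' (a) : CentralExtension.fst f (φ a) = π a := LieHom.congr_fun hφ a
  set ψ : FreeLieAlgebra K X →ₗ[K] K := CentralExtension.snd f ∘ₗ φ.toLinearMap
  have hψ (a b) : ψ ⁅a, b⁆ = f.1 (π a) (π b) := by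
    change CentralExtension.snd f (φ ⁅a, b⁆) = _
    rw [LieHom.map_lie, CentralExtension.snd_lie, hφ', hφ']
  have hk : kernelCommutators π ≤ LinearMap.ker ψ := by
    rw [kernelCommutators, LieSubmodule.lieIdeal_oper_eq_linear_span', Submodule.span_le]
    rintro _ ⟨r, hr, a, -, rfl⟩
    rw [LieHom.mem_ker] at hr
    simp [hψ, hr]
  refine ⟨Submodule.liftQ _ (ψ ∘ₗ Submodule.subtype _) fun t ht => hk ht, ?_⟩
  refine Subtype.ext (LinearMap.ext fun x => LinearMap.ext fun y => ?_)
  refine (dualToCocycle_apply π hs _ x y).trans ?_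
  change ψ ⁅s x, s y⁆ = _
  rw [hψ, hs, hs]

theorem exists_linear_section (hπ : Function.Surjective π) :
    ∃ s : L →ₗ[K] FreeLieAlgebra K X, ∀ x, π (s x) = x := by
  obtain ⟨s, hs⟩ := π.toLinearMap.exists_rightInverse_of_surjective (LinearMap.range_eq_top.2 hπ)
  exact ⟨s, fun x => LinearMap.congr_fun hs x⟩

theorem comap_kernelCommutators_le :
    (kernelCommutators π).comap (derivedSubmodule K (FreeLieAlgebra K X)).subtype ≤
      LinearMap.ker (π.toLinearMap ∘ₗ (derivedSubmodule K (FreeLieAlgebra K X)).subtype) := by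
  intro t ht
  have h : (⁅π.ker, (⊤ : LieIdeal K (FreeLieAlgebra K X))⁆ : LieIdeal K _) ≤ π.ker :=
    LieSubmodule.lie_le_left _ _
  exact LieHom.mem_ker.1 (h ht)

/-- The map `F² / [R, F] → L`. -/
noncomputable def derivedQuotientMap : DerivedQuotient π →ₗ[K] L :=
  Submodule.liftQ _ _ (comap_kernelCommutators_le π)

theorem range_derivedQuotientMap (hπ : Function.Surjective π) :
    LinearMap.range (derivedQuotientMap π) = derivedSubmodule K L := by
  rw [derivedQuotientMap, Submodule.range_liftQ, LinearMap.range_comp, Submodule.range_subtype,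
    derivedSubmodule_eq_span, derivedSubmodule_eq_span, Submodule.map_span]
  congr 1
  ext t
  constructor
  · rintro ⟨_, ⟨a, b, rfl⟩, rfl⟩
    exact ⟨π a, π b, (LieHom.map_lie π a b).symm⟩
  · rintro ⟨x, y, rfl⟩
    obtain ⟨a, rfl⟩ := hπ x
    obtain ⟨b, rfl⟩ := hπ y
    exact ⟨_, ⟨a, b, rfl⟩, LieHom.map_lie π a b⟩

/-- The inclusion of the Schur multiplier into `F² / [R, F]`. -/
noncomputable def schurMultiplierIncl : SchurMultiplier π →ₗ[K] DerivedQuotient π :=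
  Submodule.mapQ _ _ (Submodule.inclusion fun _ h => h.2) fun _ h => h

theorem schurMultiplierIncl_injective : Function.Injective (schurMultiplierIncl π) := by
  rw [← LinearMap.ker_eq_bot, LinearMap.ker_eq_bot']
  intro t ht
  obtain ⟨t, rfl⟩ := Submodule.Quotient.mk_surjective _ t
  exact (Submodule.Quotient.mk_eq_zero _).2 ((Submodule.Quotient.mk_eq_zero _).1 ht :)

/-- Exactness in the middle of 0 → M(L) → F²/[R,F] → L² → 0, from which the dimension of M(L) is
read off. -/
theorem range_schurMultiplierIncl :
    LinearMap.range (schurMultiplierIncl π) = LinearMap.ker (derivedQuotientMap π) := by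
  ext t
  constructor
  · rintro ⟨t, rfl⟩
    obtain ⟨t, rfl⟩ := Submodule.Quotient.mk_surjective _ t
    exact LieHom.mem_ker.1 t.2.1
  · intro ht
    obtain ⟨t, rfl⟩ := Submodule.Quotient.mk_surjective _ t
    exact ⟨Submodule.Quotient.mk ⟨t.1, LieHom.mem_ker.2 ht, t.2⟩, rfl⟩

variable (hc : ∀ w ∈ derivedSubmodule K L, ∀ l : L, ⁅w, l⁆ = 0)
  {V : Submodule K L} (hV : IsCompl V (derivedSubmodule K L))

-- F itself may be infinite-dimensional, so finiteness is obtained from the dual, which is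
-- identified with the finite-dimensional space of cocycles.
include hc hV in
theorem finite_derivedQuotient [FiniteDimensional K L] (hπ : Function.Surjective π) :
    Module.Finite K (DerivedQuotient π) := by
  obtain ⟨s, hs⟩ := exists_linear_section π hπ
  have := finite_scalarCocycles hc hV
  rw [← Module.finite_dual_iff K]
  exact Module.Finite.equiv (LinearEquiv.ofBijective (dualToCocycle π hs)
    ⟨dualToCocycle_injective π hs, dualToCocycle_surjective π hs⟩).symm

theorem finrank_derivedQuotient (hπ : Function.Surjective π) :
    finrank K (DerivedQuotient π) = finrank K (scalarCocycles K L) := by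
  obtain ⟨s, hs⟩ := exists_linear_section π hπ
  rw [← (LinearEquiv.ofBijective (dualToCocycle π hs)
    ⟨dualToCocycle_injective π hs, dualToCocycle_surjective π hs⟩).finrank_eq]
  -- No finiteness is needed here: for an infinite-dimensional space both ranks take the default
  -- value 0.
  exact Subspace.dual_finrank_eq.symm

include hc hV in
theorem finite_schurMultiplier [FiniteDimensional K L] (hπ : Function.Surjective π) :
    Module.Finite K (SchurMultiplier π) := by
  have := finite_derivedQuotient π hc hV hπ
  exact Module.Finite.of_injective _ (schurMultiplierIncl_injective π)

include hc hV in
/-- The dimension of the Schur multiplier of a Lie algebra of class at most two. -/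
theorem finrank_schurMultiplier [FiniteDimensional K L] (hπ : Function.Surjective π) :
    finrank K (SchurMultiplier π) + finrank K (derivedSubmodule K L) +
        finrank K (jacobiSpan (bracketOn V)) =
      (finrank K V).choose 2 + finrank K (derivedSubmodule K L) * finrank K V := by
  have := finite_derivedQuotient π hc hV hπ
  rw [← finrank_scalarCocycles hc hV, ← finrank_derivedQuotient π hπ,
    ← LinearMap.finrank_range_add_finrank_ker (derivedQuotientMap π),
    range_derivedQuotientMap π hπ, ← range_schurMultiplierIncl,
    LinearMap.finrank_range_of_inj (schurMultiplierIncl_injective π)]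
  ring

end Multiplier

/-! ### Normal forms of the bracket and recognition of the three families. -/

section Structure

variable {K L : Type*} [Field K] [LieRing L] [LieAlgebra K L]

section Pair

variable {V W : Type*} [AddCommGroup V] [Module K V] [AddCommGroup W] [Module K W]
  {β : V →ₗ[K] V →ₗ[K] W}

/-- Pulling functionals on W back along β embeds the dual of W into the alternating forms on V,
because the values of β span W. -/
theorem finrank_le_choose_two [FiniteDimensional K V] [FiniteDimensional K W]
    (hβ : ∀ v, β v v = 0) (hs : Submodule.span K {t | ∃ x y, β x y = t} = ⊤) :
    finrank K W ≤ (finrank K V).choose 2 := by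
  have e := altFormsEquivAlternatingMap K V ≪≫ₗ exteriorPower.alternatingMapLinearEquiv
  have : Module.Finite K (altForms K V) := Module.Finite.equiv e.symm
  let g : Dual K W →ₗ[K] altForms K V :=
    { toFun := fun l => ⟨β.compr₂ l, fun x => by simp [hβ]⟩
      map_add' := fun _ _ => rfl
      map_smul' := fun _ _ => rfl }
  have hg : Function.Injective g := by
    intro l l' h
    refine LinearMap.ext_on hs ?_
    rintro _ ⟨x, y, rfl⟩
    exact LinearMap.congr_fun (LinearMap.congr_fun (congrArg Subtype.val h) x) y
  rw [← finrank_altForms, ← Subspace.dual_finrank_eq]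
  exact LinearMap.finrank_le_finrank_of_injective hg

theorem apply_mem_span_of_isCompl_pairCentralizer (hβ : ∀ v, β v v = 0) {x y : V}
    (h : IsCompl (Submodule.span K {x, y}) (pairCentralizer β x y))
    (hC : ∀ c ∈ pairCentralizer β x y, ∀ c' ∈ pairCentralizer β x y, β c c' = 0) (v v' : V) :
    β v v' ∈ Submodule.span K {β x y} := by
  have hs := apply_swap_of_apply_self hβ
  have hd (v : V) : ∃ a b : K, ∃ c ∈ pairCentralizer β x y, a • x + b • y + c = v := by
    obtain ⟨u, hu, c, hc, rfl⟩ := Submodule.mem_sup.1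
      (h.sup_eq_top ▸ Submodule.mem_top : v ∈ Submodule.span K {x, y} ⊔ pairCentralizer β x y)
    obtain ⟨a, b, rfl⟩ := Submodule.mem_span_pair.1 hu
    exact ⟨a, b, c, hc, rfl⟩
  obtain ⟨a, b, c, hc, rfl⟩ := hd v
  obtain ⟨a', b', c', hc', rfl⟩ := hd v'
  have e1 : β x c = 0 := hc.1
  have e2 : β y c = 0 := hc.2
  have e3 : β x c' = 0 := hc'.1
  have e4 : β y c' = 0 := hc'.2
  refine Submodule.mem_span_singleton.2 ⟨a * b' - b * a', ?_⟩
  simp only [map_add, map_smul, LinearMap.add_apply, LinearMap.smul_apply, hβ, hs x y, hs x c,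
    hs y c, e1, e2, e3, e4, hC c hc c' hc']
  module

/-- A bracket with one-dimensional values on a space of dimension at most three is supported
on any noncommuting pair. -/
theorem isCompl_pairCentralizer_of_finrank_le_three [FiniteDimensional K V]
    (hβ : ∀ v, β v v = 0) {x y : V} (h : β x y ≠ 0) (hW : finrank K W = 1)
    (hV : finrank K V ≤ 3) :
    IsCompl (Submodule.span K {x, y}) (pairCentralizer β x y) ∧
      ∀ c ∈ pairCentralizer β x y, ∀ c' ∈ pairCentralizer β x y, β c c' = 0 := by
  have hspan (w : W) : w ∈ Submodule.span K {β x y} :=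
    Submodule.mem_span_singleton.2 ((finrank_eq_one_iff_of_nonzero' _ h).1 hW w)
  have hcompl := isCompl_pairCentralizer hβ h (fun _ => hspan _) (fun _ => hspan _)
  refine ⟨hcompl, fun c hc c' hc' => ?_⟩
  have h1 := Submodule.finrank_add_eq_of_isCompl hcompl
  rw [finrank_span_pair_of_apply_ne_zero hβ h] at h1
  -- The centralizer has dimension at most 3 - 2 = 1, and an alternating map vanishes on a line.
  obtain ⟨⟨u, hu⟩, hu'⟩ := finrank_le_one_iff.1
    (by omega : finrank K (pairCentralizer β x y) ≤ 1)
  obtain ⟨a, ha⟩ := hu' ⟨c, hc⟩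
  obtain ⟨b, hb⟩ := hu' ⟨c', hc'⟩
  obtain rfl : a • u = c := congrArg Subtype.val ha
  obtain rfl : b • u = c' := congrArg Subtype.val hb
  simp [hβ]

/-- A 2-vector in dimension three is decomposable: up to the factor c⁻¹, the given relation is β
evaluated on y + c⁻¹b x and z - c⁻¹a x. -/
theorem exists_spanning_commuting_of_relation {x y z : V}
    (hsp : ∀ v, ∃ a b c : K, a • x + b • y + c • z = v)
    (hβ : ∀ v, β v v = 0) {a b c : K} (hc : c ≠ 0)
    (h : a • β x y + b • β x z + c • β y z = 0) :
    ∃ x y z : V, (∀ v, ∃ a b c : K, a • x + b • y + c • z = v) ∧ β y z = 0 := by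
  have hs := apply_swap_of_apply_self hβ
  refine ⟨x, y + (c⁻¹ * b) • x, z - (c⁻¹ * a) • x, fun v => ?_, ?_⟩
  · obtain ⟨r, s, t, rfl⟩ := hsp v
    exact ⟨r - s * (c⁻¹ * b) + t * (c⁻¹ * a), s, t, by module⟩
  · have h' : c⁻¹ • (a • β x y + b • β x z + c • β y z) = 0 := by rw [h, smul_zero]
    rw [← h']
    simp only [map_add, map_sub, map_smul, LinearMap.add_apply, LinearMap.smul_apply, hβ, hs x y,
      smul_add, smul_smul, inv_mul_cancel₀ hc]
    module

/-- On a three-dimensional space, a bracket with values in a plane vanishes on two members of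
some basis. -/
theorem exists_spanning_commuting [FiniteDimensional K W] {x y z : V}
    (hsp : ∀ v, ∃ a b c : K, a • x + b • y + c • z = v)
    (hβ : ∀ v, β v v = 0) (hW : finrank K W < 3) :
    ∃ x y z : V, (∀ v, ∃ a b c : K, a • x + b • y + c • z = v) ∧ β y z = 0 := by
  have hs := apply_swap_of_apply_self hβ
  have hli : ¬ LinearIndependent K ![β x y, β x z, β y z] := fun hli => by
    have := hli.fintype_card_le_finrank
    simp at this
    omega
  obtain ⟨g, hg, i, hi⟩ := Fintype.not_linearIndependent_iff.1 hli
  simp only [Fin.sum_univ_three, Matrix.cons_val_zero, Matrix.cons_val_one,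
    Matrix.cons_val] at hg
  -- The three vectors are permuted so that the nonzero coefficient falls on the bracket of the last
  -- two.
  match i, hi with
  | 0, hi =>
    refine exists_spanning_commuting_of_relation (x := z) (y := x) (z := y) (a := -g 1)
        (b := -g 2) (fun v => ?_) hβ hi ?_
    · obtain ⟨r, s, t, rfl⟩ := hsp v
      exact ⟨t, r, s, by module⟩
    · rw [← hg, hs x z, hs y z]; module
  | 1, hi =>
    refine exists_spanning_commuting_of_relation (x := y) (y := x) (z := z) (a := -g 0)
        (b := g 2) (fun v => ?_) hβ hi ?_
    · obtain ⟨r, s, t, rfl⟩ := hsp v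
      exact ⟨s, r, t, by module⟩
    · rw [← hg, hs x y]; module
  | 2, hi => exact exists_spanning_commuting_of_relation hsp hβ hi hg

end Pair

variable (hc : ∀ w ∈ derivedSubmodule K L, ∀ l : L, ⁅w, l⁆ = 0)
  {V : Submodule K L} (hV : IsCompl V (derivedSubmodule K L))

include hc hV in
theorem span_bracketOn_eq_top :
    Submodule.span K {t | ∃ x y, bracketOn V x y = t} = ⊤ := by
  refine Submodule.map_injective_of_injective (derivedSubmodule K L).injective_subtype ?_
  rw [Submodule.map_subtype_top, Submodule.map_span]
  conv_rhs => rw [derivedSubmodule_eq_span]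
  congr 1
  ext t
  constructor
  · rintro ⟨_, ⟨x, y, rfl⟩, rfl⟩
    exact ⟨x, y, rfl⟩
  · rintro ⟨x, y, rfl⟩
    exact ⟨_, ⟨_, _, rfl⟩, (lie_eq_lie_projection hc hV x y).symm⟩

include hV in
/-- A Lie homomorphism whose range contains a complement of the derived subalgebra is an
isomorphism if the dimensions agree. -/
theorem nonempty_lieEquiv_of_le_range [FiniteDimensional K L] {A : Type*} [LieRing A]
    [LieAlgebra K A] [FiniteDimensional K A] (hc : ∀ w ∈ derivedSubmodule K L, ∀ l : L, ⁅w, l⁆ = 0)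
    (g : A →ₗ⁅K⁆ L) (hg : ∀ v : V, ∃ a, g a = v) (hd : finrank K A = finrank K L) :
    Nonempty (L ≃ₗ⁅K⁆ A) := by
  have hVr : V ≤ LinearMap.range g.toLinearMap := fun v hv => hg ⟨v, hv⟩
  have hWr : derivedSubmodule K L ≤ LinearMap.range g.toLinearMap := by
    rw [derivedSubmodule_eq_span, Submodule.span_le]
    rintro _ ⟨x, y, rfl⟩
    rw [lie_eq_lie_projection hc hV]
    obtain ⟨a, ha⟩ := hg (V.projectionOnto _ hV x)
    obtain ⟨b, hb⟩ := hg (V.projectionOnto _ hV y)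
    exact ⟨⁅a, b⁆, by rw [← ha, ← hb]; exact LieHom.map_lie g a b⟩
  have hs : Function.Surjective g.toLinearMap := by
    rw [← LinearMap.range_eq_top, eq_top_iff, ← hV.sup_eq_top]
    exact sup_le hVr hWr
  have hi := (LinearMap.injective_iff_surjective_of_finrank_eq_finrank hd).2 hs
  exact ⟨(LieEquiv.ofBijective g ⟨hi, hs⟩).symm⟩

instance : FiniteDimensional K (AbelianLie K k) := inferInstanceAs (FiniteDimensional K (Fin k → K))
instance : FiniteDimensional K (HeisenbergLie K) :=
  inferInstanceAs (FiniteDimensional K (Fin 3 → K))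
instance : FiniteDimensional K (LieL58 K) := inferInstanceAs (FiniteDimensional K (Fin 5 → K))
instance : FiniteDimensional K (LieL626 K) := inferInstanceAs (FiniteDimensional K (Fin 6 → K))

theorem AbelianLie.finrank_eq (K : Type*) [Field K] (k : ℕ) : finrank K (AbelianLie K k) = k :=
  finrank_fin_fun K
theorem HeisenbergLie.finrank_eq (K : Type*) [Field K] : finrank K (HeisenbergLie K) = 3 :=
  finrank_fin_fun K
theorem LieL58.finrank_eq (K : Type*) [Field K] : finrank K (LieL58 K) = 5 :=
  finrank_fin_fun K
theorem LieL626.finrank_eq (K : Type*) [Field K] : finrank K (LieL626 K) = 6 :=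
  finrank_fin_fun K

/-- The homomorphism from `H(1) ⊕ A(k)` given by elements `x, y` and a family in their
centralizer. -/
def heisenbergProdHom {k : ℕ} {x y : L} (hx : ⁅x, ⁅x, y⁆⁆ = 0) (hy : ⁅y, ⁅x, y⁆⁆ = 0)
    (e : (Fin k → K) →ₗ[K] L) (hxe : ∀ a, ⁅x, e a⁆ = 0) (hye : ∀ a, ⁅y, e a⁆ = 0)
    (hee : ∀ a b, ⁅e a, e b⁆ = 0) (hwe : ∀ a, ⁅⁅x, y⁆, e a⁆ = 0) :
    HeisenbergLie K × AbelianLie K k →ₗ⁅K⁆ L where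
  toFun p := (p.1 : Fin 3 → K) 0 • x + (p.1 : Fin 3 → K) 1 • y + (p.1 : Fin 3 → K) 2 • ⁅x, y⁆ +
    e p.2
  map_add' p q := by
    have key (p q : Fin 3 → K) (p' q' : Fin k → K) :
        (p 0 + q 0) • x + (p 1 + q 1) • y + (p 2 + q 2) • ⁅x, y⁆ + e (p' + q') =
          p 0 • x + p 1 • y + p 2 • ⁅x, y⁆ + e p' + (q 0 • x + q 1 • y + q 2 • ⁅x, y⁆ + e q') := by
      rw [map_add]
      module
    exact key p.1 q.1 p.2 q.2
  map_smul' c p := by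
    have key (p : Fin 3 → K) (p' : Fin k → K) :
        (c * p 0) • x + (c * p 1) • y + (c * p 2) • ⁅x, y⁆ + e (c • p') =
          c • (p 0 • x + p 1 • y + p 2 • ⁅x, y⁆ + e p') := by
      rw [map_smul]
      module
    exact key p.1 p.2
  map_lie' {p q} := by
    have e1 (a) : ⁅e a, x⁆ = 0 := by rw [← lie_skew, hxe, neg_zero]
    have e2 (a) : ⁅e a, y⁆ = 0 := by rw [← lie_skew, hye, neg_zero]
    have e3 (a) : ⁅e a, ⁅x, y⁆⁆ = 0 := by rw [← lie_skew, hwe, neg_zero]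
    have e4 : ⁅⁅x, y⁆, x⁆ = 0 := by rw [← lie_skew, hx, neg_zero]
    have e5 : ⁅⁅x, y⁆, y⁆ = 0 := by rw [← lie_skew, hy, neg_zero]
    have e6 : ⁅y, x⁆ = -⁅x, y⁆ := (lie_skew y x).symm
    have key (p q : Fin 3 → K) (p' q' : Fin k → K) :
        (0 : K) • x + (0 : K) • y + (p 0 * q 1 - p 1 * q 0) • ⁅x, y⁆ + e 0 =
          ⁅p 0 • x + p 1 • y + p 2 • ⁅x, y⁆ + e p', q 0 • x + q 1 • y + q 2 • ⁅x, y⁆ + e q'⁆ := by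
      simp only [add_lie, lie_add, smul_lie, lie_smul, hx, hy, hxe, hye, hee, hwe, e1, e2, e3, e4,
        e5, e6, lie_self, map_zero]
      module
    exact key p.1 q.1 p.2 q.2

/-- The homomorphism from `L_{5,8}` given by three elements. -/
def lieL58Hom (hc : ∀ w ∈ derivedSubmodule K L, ∀ l : L, ⁅w, l⁆ = 0) {x y z : L}
    (hyz : ⁅y, z⁆ = 0) : LieL58 K →ₗ⁅K⁆ L where
  toFun p := (p : Fin 5 → K) 0 • x + (p : Fin 5 → K) 1 • y + (p : Fin 5 → K) 2 • z +
    (p : Fin 5 → K) 3 • ⁅x, y⁆ + (p : Fin 5 → K) 4 • ⁅x, z⁆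
  map_add' p q := by
    change (p 0 + q 0) • x + (p 1 + q 1) • y + (p 2 + q 2) • z + (p 3 + q 3) • ⁅x, y⁆ +
      (p 4 + q 4) • ⁅x, z⁆ = _
    module
  map_smul' c p := by
    change (c * p 0) • x + (c * p 1) • y + (c * p 2) • z + (c * p 3) • ⁅x, y⁆ +
      (c * p 4) • ⁅x, z⁆ = c • _
    module
  map_lie' {p q} := by
    change (0 : K) • x + (0 : K) • y + (0 : K) • z + (p 0 * q 1 - p 1 * q 0) • ⁅x, y⁆ +
      (p 0 * q 2 - p 2 * q 0) • ⁅x, z⁆ =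
      ⁅p 0 • x + p 1 • y + p 2 • z + p 3 • ⁅x, y⁆ + p 4 • ⁅x, z⁆,
        q 0 • x + q 1 • y + q 2 • z + q 3 • ⁅x, y⁆ + q 4 • ⁅x, z⁆⁆
    have h1 (a b l : L) : ⁅⁅a, b⁆, l⁆ = 0 := hc _ (lie_mem_derivedSubmodule K L a b) l
    have h2 (a b l : L) : ⁅l, ⁅a, b⁆⁆ = 0 := by rw [← lie_skew, h1, neg_zero]
    have e1 : ⁅y, x⁆ = -⁅x, y⁆ := (lie_skew y x).symm
    have e2 : ⁅z, x⁆ = -⁅x, z⁆ := (lie_skew z x).symm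
    have e3 : ⁅z, y⁆ = 0 := by rw [← lie_skew, hyz, neg_zero]
    simp only [add_lie, lie_add, smul_lie, lie_smul, h1, h2, e1, e2, e3, hyz, lie_self]
    module

/-- The homomorphism from `L_{6,26}`, the free nilpotent Lie algebra of class two on three
generators. -/
def lieL626Hom (hc : ∀ w ∈ derivedSubmodule K L, ∀ l : L, ⁅w, l⁆ = 0) (x y z : L) :
    LieL626 K →ₗ⁅K⁆ L where
  toFun p := (p : Fin 6 → K) 0 • x + (p : Fin 6 → K) 1 • y + (p : Fin 6 → K) 2 • z +
    (p : Fin 6 → K) 3 • ⁅x, y⁆ + (p : Fin 6 → K) 4 • ⁅x, z⁆ + (p : Fin 6 → K) 5 • ⁅y, z⁆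
  map_add' p q := by
    change (p 0 + q 0) • x + (p 1 + q 1) • y + (p 2 + q 2) • z + (p 3 + q 3) • ⁅x, y⁆ +
      (p 4 + q 4) • ⁅x, z⁆ + (p 5 + q 5) • ⁅y, z⁆ = _
    module
  map_smul' c p := by
    change (c * p 0) • x + (c * p 1) • y + (c * p 2) • z + (c * p 3) • ⁅x, y⁆ +
      (c * p 4) • ⁅x, z⁆ + (c * p 5) • ⁅y, z⁆ = c • _
    module
  map_lie' {p q} := by
    change (0 : K) • x + (0 : K) • y + (0 : K) • z + (p 0 * q 1 - p 1 * q 0) • ⁅x, y⁆ +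
      (p 0 * q 2 - p 2 * q 0) • ⁅x, z⁆ + (p 1 * q 2 - p 2 * q 1) • ⁅y, z⁆ =
      ⁅p 0 • x + p 1 • y + p 2 • z + p 3 • ⁅x, y⁆ + p 4 • ⁅x, z⁆ + p 5 • ⁅y, z⁆,
        q 0 • x + q 1 • y + q 2 • z + q 3 • ⁅x, y⁆ + q 4 • ⁅x, z⁆ + q 5 • ⁅y, z⁆⁆
    have h1 (a b l : L) : ⁅⁅a, b⁆, l⁆ = 0 := hc _ (lie_mem_derivedSubmodule K L a b) l
    have h2 (a b l : L) : ⁅l, ⁅a, b⁆⁆ = 0 := by rw [← lie_skew, h1, neg_zero]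
    have e1 : ⁅y, x⁆ = -⁅x, y⁆ := (lie_skew y x).symm
    have e2 : ⁅z, x⁆ = -⁅x, z⁆ := (lie_skew z x).symm
    have e3 : ⁅z, y⁆ = -⁅y, z⁆ := (lie_skew z y).symm
    simp only [add_lie, lie_add, smul_lie, lie_smul, h1, h2, e1, e2, e3, lie_self]
    module

-- The pair x, y generates H(1), and its centralizer in V is abelian of dimension d - 2. All
-- brackets are multiples of [x, y], so m = 1 and d - 2 = n - 3.
include hc hV in
theorem nonempty_lieEquiv_heisenbergProd [FiniteDimensional K L] {x y : V}
    (h : bracketOn V x y ≠ 0)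
    (hC : IsCompl (Submodule.span K {x, y}) (pairCentralizer (bracketOn V) x y))
    (hC' : ∀ c ∈ pairCentralizer (bracketOn V) x y, ∀ c' ∈ pairCentralizer (bracketOn V) x y,
      bracketOn V c c' = 0) :
    Nonempty (L ≃ₗ⁅K⁆ HeisenbergLie K × AbelianLie K (finrank K L - 3)) := by
  have hW : finrank K (derivedSubmodule K L) = 1 := by
    rw [finrank_eq_one_iff_of_nonzero _ h, eq_top_iff, ← span_bracketOn_eq_top hc hV,
      Submodule.span_le]
    rintro _ ⟨v, v', rfl⟩
    exact apply_mem_span_of_isCompl_pairCentralizer (bracketOn_self V) hC hC' v v'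
  have h1 := Submodule.finrank_add_eq_of_isCompl hC
  have h2 := Submodule.finrank_add_eq_of_isCompl hV
  rw [finrank_span_pair_of_apply_ne_zero (bracketOn_self V) h] at h1
  have h3 : finrank K (Fin (finrank K L - 3) → K) =
      finrank K (pairCentralizer (bracketOn V) x y) := by
    rw [finrank_fin_fun]; omega
  let e := LinearEquiv.ofFinrankEq _ _ h3
  have hc' (a b l : L) : ⁅l, ⁅a, b⁆⁆ = 0 := by
    rw [← lie_skew, hc _ (lie_mem_derivedSubmodule K L a b), neg_zero]
  let g := heisenbergProdHom (K := K) (x := (x : L)) (y := (y : L)) (hc' _ _ _) (hc' _ _ _)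
    (V.subtype ∘ₗ (pairCentralizer (bracketOn V) x y).subtype ∘ₗ e.toLinearMap)
    (fun a => congrArg Subtype.val (e a).2.1) (fun a => congrArg Subtype.val (e a).2.2)
    (fun a b => congrArg Subtype.val (hC' _ (e a).2 _ (e b).2))
    (fun a => hc _ (lie_mem_derivedSubmodule K L _ _) _)
  refine nonempty_lieEquiv_of_le_range hV hc g (fun v => ?_) ?_
  · obtain ⟨u, hu, c, hc, rfl⟩ := Submodule.mem_sup.1
      (hC.sup_eq_top ▸ Submodule.mem_top :
        v ∈ Submodule.span K {x, y} ⊔ pairCentralizer (bracketOn V) x y)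
    obtain ⟨a, b, rfl⟩ := Submodule.mem_span_pair.1 hu
    refine ⟨((![a, b, 0] : Fin 3 → K), e.symm ⟨c, hc⟩), ?_⟩
    change a • (x : L) + b • (y : L) + (0 : K) • ⁅(x : L), (y : L)⁆ +
      ((e (e.symm ⟨c, hc⟩) : V) : L) = _
    simp
  · rw [finrank_prod, HeisenbergLie.finrank_eq, AbelianLie.finrank_eq]
    omega

include hc hV in
theorem nonempty_lieEquiv_lieL58 [FiniteDimensional K L] {x y z : V}
    (hsp : ∀ v, ∃ a b c : K, a • x + b • y + c • z = v) (hyz : bracketOn V y z = 0)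
    (hd : finrank K L = 5) : Nonempty (L ≃ₗ⁅K⁆ LieL58 K) := by
  refine nonempty_lieEquiv_of_le_range hV hc
    (lieL58Hom (x := (x : L)) hc (congrArg Subtype.val hyz :)) (fun v => ?_)
    ((LieL58.finrank_eq K).trans hd.symm)
  obtain ⟨a, b, c, rfl⟩ := hsp v
  refine ⟨(![a, b, c, 0, 0] : Fin 5 → K), ?_⟩
  change a • (x : L) + b • (y : L) + c • (z : L) + (0 : K) • ⁅(x : L), (y : L)⁆ +
    (0 : K) • ⁅(x : L), (z : L)⁆ = _
  simp

include hc hV in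
theorem nonempty_lieEquiv_lieL626 [FiniteDimensional K L] {x y z : V}
    (hsp : ∀ v, ∃ a b c : K, a • x + b • y + c • z = v)
    (hd : finrank K L = 6) : Nonempty (L ≃ₗ⁅K⁆ LieL626 K) := by
  refine nonempty_lieEquiv_of_le_range hV hc
    (lieL626Hom hc (x : L) y z) (fun v => ?_)
    ((LieL626.finrank_eq K).trans hd.symm)
  obtain ⟨a, b, c, rfl⟩ := hsp v
  refine ⟨(![a, b, c, 0, 0, 0] : Fin 6 → K), ?_⟩
  change a • (x : L) + b • (y : L) + c • (z : L) + (0 : K) • ⁅(x : L), (y : L)⁆ +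
    (0 : K) • ⁅(x : L), (z : L)⁆ + (0 : K) • ⁅(y : L), (z : L)⁆ = _
  simp

-- For d ≥ 4 extremality forces the Heisenberg shape. For d ≤ 3 extremality plays no role: m = 1 is
-- again Heisenberg, d = 2 allows only m = 1, and for d = 3 the value m = 2 provides two commuting
-- generators while m = 3 makes L free of class two.
include hc hV in
theorem classification_of_finrank_jacobiSpan [FiniteDimensional K L] {x y : V}
    (h : bracketOn V x y ≠ 0)
    (hr : finrank K (jacobiSpan (bracketOn V)) + 2 = finrank K V) :
    Nonempty (L ≃ₗ⁅K⁆ HeisenbergLie K × AbelianLie K (finrank K L - 3)) ∨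
      Nonempty (L ≃ₗ⁅K⁆ LieL58 K) ∨ Nonempty (L ≃ₗ⁅K⁆ LieL626 K) := by
  have hβ := bracketOn_self V
  have h2 := Submodule.finrank_add_eq_of_isCompl hV
  have hm := finrank_le_choose_two hβ (span_bracketOn_eq_top hc hV)
  have hm0 : 0 < finrank K (derivedSubmodule K L) := finrank_pos_iff_exists_ne_zero.2 ⟨_, h⟩
  rcases le_or_gt 4 (finrank K V) with hd | hd
  · obtain ⟨hC, hC'⟩ := isCompl_pairCentralizer_of_finrank_jacobiSpan hβ h hr hd
    exact Or.inl (nonempty_lieEquiv_heisenbergProd hc hV h hC hC')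
  by_cases hm1 : finrank K (derivedSubmodule K L) = 1
  · obtain ⟨hC, hC'⟩ := isCompl_pairCentralizer_of_finrank_le_three hβ h hm1 (by omega)
    exact Or.inl (nonempty_lieEquiv_heisenbergProd hc hV h hC hC')
  obtain hd2 | hd3 : finrank K V = 2 ∨ finrank K V = 3 := by omega
  · rw [hd2, Nat.choose_self] at hm
    omega
  have hm3 : finrank K (derivedSubmodule K L) ≤ 3 := by rwa [hd3] at hm
  let b := finBasisOfFinrankEq K V hd3
  have hsp (v : V) : ∃ r s t : K, r • b 0 + s • b 1 + t • b 2 = v :=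
    ⟨b.repr v 0, b.repr v 1, b.repr v 2, by rw [← Fin.sum_univ_three fun i => b.repr v i • b i,
      b.sum_repr]⟩
  rcases hm3.lt_or_eq with hm3 | hm3
  · obtain ⟨x, y, z, hsp', hyz⟩ := exists_spanning_commuting hsp hβ hm3
    exact Or.inr (Or.inl (nonempty_lieEquiv_lieL58 hc hV hsp' hyz (by omega)))
  · exact Or.inr (Or.inr (nonempty_lieEquiv_lieL626 hc hV hsp (by omega)))

/-! ### The listed algebras have the smallest possible Jacobi span. -/

/-- Here the bracket is (α₀ ∧ α₁) ⊗ w, with α₀, α₁ the first two Heisenberg coordinates and w the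
element corresponding to the central basis vector x₃, so `finrank_jacobiSpan_add_two_le` applies. -/
theorem finrank_jacobiSpan_of_lieEquiv_heisenbergProd [FiniteDimensional K L] {k : ℕ}
    (e : L ≃ₗ⁅K⁆ HeisenbergLie K × AbelianLie K k) {x y : V} (h : bracketOn V x y ≠ 0) :
    finrank K (jacobiSpan (bracketOn V)) + 2 ≤ finrank K V := by
  let α (i : Fin 3) : V →ₗ[K] K :=
    (LinearMap.proj i : (Fin 3 → K) →ₗ[K] K) ∘ₗ
      LinearMap.fst K (HeisenbergLie K) (AbelianLie K k) ∘ₗ e.toLinearEquiv.toLinearMap ∘ₗ V.subtype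
  let p (a b c : K) : HeisenbergLie K × AbelianLie K k := ((![a, b, c] : Fin 3 → K), 0)
  have hp : ⁅p 1 0 0, p 0 1 0⁆ = p 0 0 1 := by
    refine Prod.ext ?_ rfl
    change (![0, 0, 1 * 1 - 0 * 0] : Fin 3 → K) = ![0, 0, 1]
    simp
  refine finrank_jacobiSpan_add_two_le (bracketOn_self V) h (α 0) (α 1)
    ⟨e.symm (p 0 0 1), ?_⟩ fun a b => ?_
  · rw [← hp, LieEquiv.map_lie]
    exact lie_mem_derivedSubmodule K L _ _
  · refine Subtype.ext (e.injective ?_)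
    change e ⁅(a : L), (b : L)⁆ = e ((α 0 a * α 1 b - α 1 a * α 0 b) • e.symm (p 0 0 1))
    rw [LieEquiv.map_lie, map_smul, e.apply_symm_apply]
    refine Prod.ext ?_ (smul_zero _).symm
    have key (t : K) : (![0, 0, t] : Fin 3 → K) = t • ![0, 0, 1] := by
      ext i; fin_cases i <;> simp
    exact key (α 0 a * α 1 b - α 1 a * α 0 b)

-- Projecting to V kills brackets, so V is the image of the three-dimensional space that supplies
-- the rest of A.
include hV in
theorem finrank_le_three_of_lieEquiv [FiniteDimensional K L] {A : Type*} [LieRing A]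
    [LieAlgebra K A] (e : L ≃ₗ⁅K⁆ A) (g : (Fin 3 → K) →ₗ[K] A)
    (hg : ∀ a, ∃ (c : Fin 3 → K) (u u' r r' : A), a = g c + ⁅u, u'⁆ + ⁅r, r'⁆) :
    finrank K V ≤ 3 := by
  have hs : Function.Surjective
      (V.projectionOnto _ hV ∘ₗ e.symm.toLinearEquiv.toLinearMap ∘ₗ g) := by
    intro v
    obtain ⟨c, u, u', r, r', h⟩ := hg (e v)
    refine ⟨c, ?_⟩
    rw [← Submodule.projectionOnto_apply_left hV v, ← e.symm_apply_apply (v : L), h, map_add,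
      map_add, map_add, map_add, LieEquiv.map_lie, LieEquiv.map_lie, projectionOnto_lie,
      projectionOnto_lie, add_zero, add_zero]
    rfl
  simpa using LinearMap.finrank_le_finrank_of_surjective hs

include hV in
theorem finrank_le_three_of_lieEquiv_lieL58 [FiniteDimensional K L] (e : L ≃ₗ⁅K⁆ LieL58 K) :
    finrank K V ≤ 3 := by
  let g : (Fin 3 → K) →ₗ[K] (Fin 5 → K) :=
    { toFun := fun c => ![c 0, c 1, c 2, 0, 0]
      map_add' := fun c d => by ext i; fin_cases i <;> simp
      map_smul' := fun c d => by ext i; fin_cases i <;> simp }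
  refine finrank_le_three_of_lieEquiv hV e (A := LieL58 K) g fun a => ?_
  -- The central part is the single bracket [x₁, a₃x₂ + a₄x₃], with coordinates counted from 0.
  refine ⟨![a 0, a 1, a 2], (![1, 0, 0, 0, 0] : Fin 5 → K),
    (![0, a 3, a 4, 0, 0] : Fin 5 → K), 0, 0, ?_⟩
  rw [lie_zero, add_zero]
  have key (a : Fin 5 → K) : a = ![a 0, a 1, a 2, 0, 0] +
    ![0, 0, 0, 1 * a 3 - 0 * 0, 1 * a 4 - 0 * 0] := by
    ext i; fin_cases i <;> simp
  exact key a

include hV in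
theorem finrank_le_three_of_lieEquiv_lieL626 [FiniteDimensional K L] (e : L ≃ₗ⁅K⁆ LieL626 K) :
    finrank K V ≤ 3 := by
  let g : (Fin 3 → K) →ₗ[K] (Fin 6 → K) :=
    { toFun := fun c => ![c 0, c 1, c 2, 0, 0, 0]
      map_add' := fun c d => by ext i; fin_cases i <;> simp
      map_smul' := fun c d => by ext i; fin_cases i <;> simp }
  refine finrank_le_three_of_lieEquiv hV e (A := LieL626 K) g fun a => ?_
  -- The central part is [x₁, a₃x₂ + a₄x₃] + [x₂, a₅x₃], with coordinates counted from 0.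
  refine ⟨![a 0, a 1, a 2], (![1, 0, 0, 0, 0, 0] : Fin 6 → K),
    (![0, a 3, a 4, 0, 0, 0] : Fin 6 → K), (![0, 1, 0, 0, 0, 0] : Fin 6 → K),
    (![0, 0, a 5, 0, 0, 0] : Fin 6 → K), ?_⟩
  have key (a : Fin 6 → K) : a = ![a 0, a 1, a 2, 0, 0, 0] +
    ![0, 0, 0, 1 * a 3 - 0 * 0, 1 * a 4 - 0 * 0, 0 * a 4 - 0 * a 3] +
    ![0, 0, 0, 0 * 0 - 1 * 0, 0 * a 5 - 0 * 0, 1 * a 5 - 0 * 0] := by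
    ext i; fin_cases i <;> simp
  exact key a

/-- For d = 2 and d = 3 the bound C(d,3) coming from Λ³V coincides with d - 2. -/
theorem finrank_jacobiSpan_of_finrank_le_three [FiniteDimensional K L] {x y : V}
    (h : bracketOn V x y ≠ 0)
    (hd : finrank K V ≤ 3) : finrank K (jacobiSpan (bracketOn V)) + 2 ≤ finrank K V := by
  have h1 := finrank_jacobiSpan_le_choose (bracketOn V) (bracketOn_self V)
  have h2 := finrank_quotient_span_pair (bracketOn_self V) h
  have h3 : Nat.choose 2 3 = 0 := rfl
  obtain hd | hd : finrank K V = 2 ∨ finrank K V = 3 := by omega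
  · rw [hd, h3] at h1
    omega
  · rw [hd, Nat.choose_self] at h1
    omega

include hc hV in
/-- The Jacobi span has the least possible dimension exactly for the three listed families. -/
theorem finrank_jacobiSpan_eq_iff [FiniteDimensional K L] {x y : V}
    (h : bracketOn V x y ≠ 0) :
    finrank K (jacobiSpan (bracketOn V)) + 2 = finrank K V ↔
      Nonempty (L ≃ₗ⁅K⁆ HeisenbergLie K × AbelianLie K (finrank K L - 3)) ∨
      Nonempty (L ≃ₗ⁅K⁆ LieL58 K) ∨ Nonempty (L ≃ₗ⁅K⁆ LieL626 K) := by
  refine ⟨classification_of_finrank_jacobiSpan hc hV h, fun hiso => le_antisymm ?_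
    (finrank_le_finrank_jacobiSpan_add_two (bracketOn_self V) h)⟩
  rcases hiso with ⟨⟨e⟩⟩ | ⟨⟨e⟩⟩ | ⟨⟨e⟩⟩
  · exact finrank_jacobiSpan_of_lieEquiv_heisenbergProd e h
  · exact finrank_jacobiSpan_of_finrank_le_three h (finrank_le_three_of_lieEquiv_lieL58 hV e)
  · exact finrank_jacobiSpan_of_finrank_le_three h (finrank_le_three_of_lieEquiv_lieL626 hV e)

theorem lie_eq_zero_of_nilpotencyLength_eq_two [LieRing.IsNilpotent L]
    (h : LieModule.nilpotencyLength L L = 2) :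
    (∀ w ∈ derivedSubmodule K L, ∀ l : L, ⁅w, l⁆ = 0) ∧ derivedSubmodule K L ≠ ⊥ := by
  obtain ⟨h1, h2⟩ := (LieModule.nilpotencyLength_eq_succ_iff K L L 1).1 h
  rw [LieModule.lowerCentralSeries_succ] at h1
  simp only [LieModule.lowerCentralSeries_succ, LieModule.lowerCentralSeries_zero] at h1 h2
  rw [LieSubmodule.lie_eq_bot_iff] at h1
  refine ⟨fun w hw l => ?_, fun h0 => h2 ?_⟩
  · rw [← lie_skew, h1 l (LieSubmodule.mem_top l) w hw, neg_zero]
  · rwa [LieSubmodule.toSubmodule_eq_bot] at h0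

/-- Since d ≥ 2, the sum has the single term d - 2, and (d - 1)(d + 2m)/2 = C(d,2) + md - m. -/
theorem raiBound_two {d m : ℕ} (hd : 2 ≤ d) :
    raiBound (d + m) m 2 = ((d.choose 2 + m * d : ℕ) : ℚ) - m - (d - 2) := by
  have h : min (d + m - m) 2 = 2 := by omega
  rw [raiBound, h, Finset.Icc_self, Finset.sum_singleton, Nat.cast_add,
    Nat.cast_add, Nat.cast_choose_two]
  push_cast
  ring

end Structure

/-! ### The characterization of equality. -/

theorem theorem22 {K : Type*} [Field K] {L : Type*} [LieRing L] [LieAlgebra K L]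
    [FiniteDimensional K L] [LieRing.IsNilpotent L]
    (hclass : LieModule.nilpotencyLength L L = 2)
    (n m : ℕ) (hn : Module.finrank K L = n)
    (hm : Module.finrank K (⁅(⊤ : LieIdeal K L), (⊤ : LieIdeal K L)⁆ : LieIdeal K L) = m)
    {X : Type*} (π : FreeLieAlgebra K X →ₗ⁅K⁆ L) (hπ : Function.Surjective π) :
    FiniteDimensional K (SchurMultiplier π) ∧
      ((Module.finrank K (SchurMultiplier π) : ℚ) = raiBound n m 2 ↔
        Nonempty (L ≃ₗ⁅K⁆ HeisenbergLie K × AbelianLie K (n - 3)) ∨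
          Nonempty (L ≃ₗ⁅K⁆ LieL58 K) ∨ Nonempty (L ≃ₗ⁅K⁆ LieL626 K)) := by
  obtain ⟨hc, hW⟩ := lie_eq_zero_of_nilpotencyLength_eq_two (K := K) hclass
  obtain ⟨V, hV⟩ := (derivedSubmodule K L).exists_isCompl
  replace hV := hV.symm
  refine ⟨finite_schurMultiplier π hc hV hπ, ?_⟩
  obtain ⟨x, y, hxy⟩ : ∃ x y : V, bracketOn V x y ≠ 0 := by
    by_contra! h0
    refine hW ?_
    rw [derivedSubmodule_eq_span, Submodule.span_eq_bot]
    rintro _ ⟨a, b, rfl⟩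
    rw [lie_eq_lie_projection hc hV]
    exact congrArg Subtype.val (h0 _ _)
  have hm' : finrank K (derivedSubmodule K L) = m := hm
  have hsum := Submodule.finrank_add_eq_of_isCompl hV
  have h2 := finrank_quotient_span_pair (bracketOn_self V) hxy
  have hM := finrank_schurMultiplier π hc hV hπ
  rw [hm'] at hsum hM
  have hM' := congrArg (Nat.cast : ℕ → ℚ) hM
  -- After substituting the dimension formula for M(L), both sides of the equivalence say dim J + 2
  -- = d.
  rw [← hn, ← finrank_jacobiSpan_eq_iff hc hV hxy, ← hsum, raiBound_two (by omega), ← hM',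
    ← @Nat.cast_inj ℚ]
  push_cast
  constructor <;> intro h <;> linarith
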